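/- A one-sided task consists of finite-dimensional quantum systems $A_0,A_1$ (of positive dimension), a set of classical inputs $x$, and a unitary $\mathbf U^x$ on $A_0A_1$ for each $x$. Both $A_0$ and $A_1$ are received on the left and $x$ is received on the right; $\mathbf U^x$ has to be applied, with $A_0$ output on the left and $A_1$ on the right. For $\delta\ge 0$, the entanglement cost $E=E_\delta$ is the least number of EPR pairs $|\Psi^+\rangle_{V_0V_1}$ in a non-local protocol $$\rho\mapsto \mathrm{tr}_{Z_0Z_1}\Big([\mathbf W^{L,x}_{X_0Y_0\to A_0Z_0}\otimes \mathbf W^{R,x}_{X_1Y_1\to A_1Z_1}][\mathbf V^L_{A_0A_1V_0\to X_0X_1}\otimes \mathbf V^{R,x}_{V_1\to Y_0Y_1}]\,\big(\rho\otimes\Psi^+_{V_0V_1}\big)\,[\cdots]^\dagger\Big)$$ built from isometries, which for every $x$ is within $\delta$ of the channel $\mathbf U^x\cdot(\mathbf U^x)^\dagger$ in diamond norm ($\delta=0$: exact implementation). For $\varepsilon>0$, let $n'=n'_\varepsilon$ be the minimal number of qubits brought into the interaction unitary, that is, the minimum of $\log_2\dim A_0'A_1'$ over all unitaries $\mathbf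 U^I$ acting on a system $A_0'A_1'$, where $A_0'$ and $A_1'$ are qubit registers, such that for some isometries the channels $$\rho\mapsto \mathrm{tr}_{Z_0Z_1}\Big([\mathbf W^{L,x}_{A_0'X_0Y_0\to A_0Z_0}\otimes \mathbf W^{R,x}_{A_1'X_1Y_1\to A_1Z_1}]\,\mathbf U^I_{A_0'A_1'}\,[\mathbf V^L_{A_0A_1\to A_0'X_0X_1}\otimes \mathbf V^{R,x}_{\mathbb C\to A_1'Y_0Y_1}]\,\rho\,[\cdots]^\dagger\Big)$$ are, for every $x$, within $\varepsilon$ of $\mathbf U^x\cdot(\mathbf U^x)^\dagger$ in diamond norm. Here $\mathbf U^I$ and $\mathbf V^L$ do not depend on $x$. Then $E=\Omega(\log n')$. More precisely, for all $0\le\delta<\varepsilon$ there are constants $c,C>0$, depending only on $\delta$ and $\varepsilon$, such that for every one-sided task with finite entanglement cost $E=E_\delta$, the number $n'=n'_\varepsilon$ is finite and $$n'\le C\,2^{8E},\qquad\text{and}\qquad E\ \ge\ c\,\log_2 n'\quad\text{whenever } n'\ge 1 .$$ -/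

import Mathlib

open scoped Matrix Kronecker ENNReal

noncomputable section

/-! ### Linear maps between finite-dimensional Hilbert spaces, trace norm, diamond norm

The Hilbert space with orthonormal basis indexed by a finite type `ι` is `ℂ^ι`.  Operators
`ℂ^ι → ℂ^κ` are matrices `Matrix κ ι ℂ`, and a tensor product of spaces is indexed by a product
of index types. -/

/-- Computational basis labels of a register of `n` qubits (a space of dimension `2 ^ n`). -/
abbrev Qubits (n : ℕ) : Type := Fin n → Fin 2

/-- `V : ℂ^ι → ℂ^κ` is an isometry. -/
def Matrix.IsIsometry {κ ι : Type*} [Fintype κ] [DecidableEq ι] (V : Matrix κ ι ℂ) : Prop :=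
  Vᴴ * V = 1

/-- The trace norm `‖A‖₁ = tr √(A† A)`, the sum of the singular values of `A`. -/
def traceNorm {ι : Type*} [Fintype ι] [DecidableEq ι] (A : Matrix ι ι ℂ) : ℝ :=
  ∑ i, √((Matrix.isHermitian_conjTranspose_mul_self A).eigenvalues i)

/-- A map on the operators of a quantum system `ι`, with values in the operators of a system `κ`. -/
abbrev SuperOp (ι κ : Type*) := Matrix ι ι ℂ → Matrix κ κ ℂ

/-- `Φ ⊗ id` on the operators of the system `ι` together with a reference system of
dimension `k`. -/
def SuperOp.tensorId {ι κ : Type*} (Φ : SuperOp ι κ) (k : ℕ) :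
    SuperOp (ι × Fin k) (κ × Fin k) :=
  fun X => Matrix.of fun p q => Φ (Matrix.of fun i j => X (i, p.2) (j, q.2)) p.1 q.1

/-- The diamond norm `‖Φ‖_⋄ = sup_k sup_{‖X‖₁ ≤ 1} ‖(Φ ⊗ id_k)(X)‖₁`. -/
def diamondNorm {ι κ : Type*} [Fintype ι] [DecidableEq ι] [Fintype κ] [DecidableEq κ]
    (Φ : SuperOp ι κ) : ℝ≥0∞ :=
  ⨆ (k : ℕ) (X : Matrix (ι × Fin k) (ι × Fin k) ℂ) (_ : traceNorm X ≤ 1),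
    ENNReal.ofReal (traceNorm (Φ.tensorId k X))

/-- The map `ρ ↦ M ρ M†`. -/
def conjBy {ι κ : Type*} [Fintype ι] (M : Matrix κ ι ℂ) : SuperOp ι κ :=
  fun ρ => M * ρ * Mᴴ

/-- Partial trace over `Z₀` and `Z₁` of an operator on `(A₀ ⊗ Z₀) ⊗ (A₁ ⊗ Z₁)`. -/
def traceOutZ {A₀ Z₀ A₁ Z₁ : Type*} [Fintype Z₀] [Fintype Z₁]
    (ρ : Matrix ((A₀ × Z₀) × (A₁ × Z₁)) ((A₀ × Z₀) × (A₁ × Z₁)) ℂ) :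
    Matrix (A₀ × A₁) (A₀ × A₁) ℂ :=
  Matrix.of fun a b => ∑ z₀, ∑ z₁, ρ ((a.1, z₀), (a.2, z₁)) ((b.1, z₀), (b.2, z₁))

/-! ### One-sided tasks -/

/-- A one-sided task.  The left receives the quantum systems `A₀` and `A₁` of dimensions `d₀` and
`d₁`, the right receives a classical input `x`, which specifies the unitary `U x` on `A₀A₁`.
The systems `A₀` and `A₁` have to be output on the left and on the right respectively, after
`U x` has been applied to them. -/
structure OneSidedTask where
  /-- dimension of `A₀` -/
  d₀ : ℕ
  /-- dimension of `A₁` -/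
  d₁ : ℕ
  d₀_pos : 0 < d₀
  d₁_pos : 0 < d₁
  /-- the set of possible classical inputs -/
  Input : Type
  U : Input → Matrix.unitaryGroup (Fin d₀ × Fin d₁) ℂ

namespace OneSidedTask

variable (T : OneSidedTask)

/-- Basis labels of `A₀`. -/
abbrev A₀ : Type := Fin T.d₀

/-- Basis labels of `A₁`. -/
abbrev A₁ : Type := Fin T.d₁

/-! ### Non-local implementations with `E` EPR pairs -/

/-- The product of `E` EPR pairs `(|00⟩ + |11⟩) / √2`, as a vector in `V₀ ⊗ V₁`, where `V₀` holds the
first and `V₁` the second qubit of each pair. -/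
def eprAmplitude (E : ℕ) (v₀ v₁ : Qubits E) : ℂ :=
  ∏ i, if v₀ i = v₁ i then ((1 / √2 : ℝ) : ℂ) else 0

/-- Adjoining `E` EPR pairs: `|ψ⟩ ↦ |ψ⟩ ⊗ |Ψ⁺⟩_{V₀V₁}`. -/
def adjoinEPR (A : Type*) [DecidableEq A] (E : ℕ) :
    Matrix ((A × Qubits E) × Qubits E) A ℂ :=
  Matrix.of fun p a => if p.1.1 = a then eprAmplitude E p.1.2 p.2 else 0

/-- A non-local protocol for a one-sided task, with `E` EPR pairs shared between `V₀` (left) and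
`V₁` (right).  The left applies an isometry `A₀A₁V₀ → X₀X₁`, the right an isometry
`V₁ → Y₀Y₁`; then, in one simultaneous round of communication, `X₁` is sent to the right and `Y₀`
to the left; finally isometries `X₀Y₀ → A₀Z₀` and `X₁Y₁ → A₁Z₁` are applied, and `Z₀`, `Z₁` are
discarded.  The classical input `x` is known on the right in the first step and, since it can be
copied and sent, on both sides in the last step. -/
structure NonlocalProtocol (E : ℕ) where
  (X₀ X₁ Y₀ Y₁ Z₀ Z₁ : Type)
  [fX₀ : Fintype X₀] [fX₁ : Fintype X₁] [fY₀ : Fintype Y₀] [fY₁ : Fintype Y₁]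
  [fZ₀ : Fintype Z₀] [fZ₁ : Fintype Z₁]
  [dX₀ : DecidableEq X₀] [dX₁ : DecidableEq X₁] [dY₀ : DecidableEq Y₀] [dY₁ : DecidableEq Y₁]
  VL : Matrix (X₀ × X₁) ((T.A₀ × T.A₁) × Qubits E) ℂ
  VR : T.Input → Matrix (Y₀ × Y₁) (Qubits E) ℂ
  WL : T.Input → Matrix (T.A₀ × Z₀) (X₀ × Y₀) ℂ
  WR : T.Input → Matrix (T.A₁ × Z₁) (X₁ × Y₁) ℂ
  VL_isometry : VL.IsIsometry
  VR_isometry : ∀ x, (VR x).IsIsometry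
  WL_isometry : ∀ x, (WL x).IsIsometry
  WR_isometry : ∀ x, (WR x).IsIsometry

attribute [instance] NonlocalProtocol.fX₀ NonlocalProtocol.fX₁ NonlocalProtocol.fY₀
  NonlocalProtocol.fY₁ NonlocalProtocol.fZ₀ NonlocalProtocol.fZ₁ NonlocalProtocol.dX₀
  NonlocalProtocol.dX₁ NonlocalProtocol.dY₀ NonlocalProtocol.dY₁

variable {T}

/-- `(W^{L,x} ⊗ W^{R,x}) (V^L ⊗ V^{R,x}) (|ψ⟩ ⊗ |Ψ⁺⟩)` as a linear map in `|ψ⟩`. -/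
def NonlocalProtocol.operator {E : ℕ} (P : T.NonlocalProtocol E) (x : T.Input) :
    Matrix ((T.A₀ × P.Z₀) × (T.A₁ × P.Z₁)) (T.A₀ × T.A₁) ℂ :=
  (P.WL x ⊗ₖ P.WR x) *
    ((P.VL ⊗ₖ P.VR x) * adjoinEPR (T.A₀ × T.A₁) E).submatrix
      (fun p : (P.X₀ × P.Y₀) × (P.X₁ × P.Y₁) => ((p.1.1, p.2.1), (p.1.2, p.2.2))) id

/-- The channel on `A₀A₁` that the protocol implements on input `x`. -/
def NonlocalProtocol.channel {E : ℕ} (P : T.NonlocalProtocol E) (x : T.Input) :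
    SuperOp (T.A₀ × T.A₁) (T.A₀ × T.A₁) :=
  fun ρ => traceOutZ (conjBy (P.operator x) ρ)

variable (T)

/-- The least number of EPR pairs in a non-local protocol which, for every input `x`, implements
`U x` up to `δ` in diamond norm (`⊤` if there is none).  For `δ = 0` the protocol is exact. -/
def entanglementCost (δ : ℝ) : ℕ∞ :=
  ⨅ (E : ℕ) (_ : ∃ P : T.NonlocalProtocol E, ∀ x,
    diamondNorm (conjBy (T.U x : Matrix (T.A₀ × T.A₁) (T.A₀ × T.A₁) ℂ) - P.channel x)
      ≤ ENNReal.ofReal δ), (E : ℕ∞)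

/-! ### Local implementations by an interaction unitary -/

/-- A local protocol for a one-sided task, without shared entanglement.  The left applies an isometry
`A₀A₁ → A₀'X₀X₁`, the right prepares a state of `A₁'Y₀Y₁` depending on `x`.
The unitary `UI` acts on `A₀'A₁'`, where `A₀'` consists of `a` and `A₁'` of `b` qubits; it does not
depend on `x` otherwise than through the system `A₁'`.
Then isometries `A₀'X₀Y₀ → A₀Z₀` and `A₁'X₁Y₁ → A₁Z₁` are applied, and `Z₀`, `Z₁` are discarded. -/
structure InteractionProtocol (a b : ℕ) where
  (X₀ X₁ Y₀ Y₁ Z₀ Z₁ : Type)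
  [fX₀ : Fintype X₀] [fX₁ : Fintype X₁] [fY₀ : Fintype Y₀] [fY₁ : Fintype Y₁]
  [fZ₀ : Fintype Z₀] [fZ₁ : Fintype Z₁]
  [dX₀ : DecidableEq X₀] [dX₁ : DecidableEq X₁] [dY₀ : DecidableEq Y₀] [dY₁ : DecidableEq Y₁]
  VL : Matrix (Qubits a × (X₀ × X₁)) (T.A₀ × T.A₁) ℂ
  VR : T.Input → Matrix (Qubits b × (Y₀ × Y₁)) Unit ℂ
  UI : Matrix.unitaryGroup (Qubits a × Qubits b) ℂ
  WL : T.Input → Matrix (T.A₀ × Z₀) (Qubits a × (X₀ × Y₀)) ℂ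
  WR : T.Input → Matrix (T.A₁ × Z₁) (Qubits b × (X₁ × Y₁)) ℂ
  VL_isometry : VL.IsIsometry
  VR_isometry : ∀ x, (VR x).IsIsometry
  WL_isometry : ∀ x, (WL x).IsIsometry
  WR_isometry : ∀ x, (WR x).IsIsometry

attribute [instance] InteractionProtocol.fX₀ InteractionProtocol.fX₁ InteractionProtocol.fY₀
  InteractionProtocol.fY₁ InteractionProtocol.fZ₀ InteractionProtocol.fZ₁ InteractionProtocol.dX₀
  InteractionProtocol.dX₁ InteractionProtocol.dY₀ InteractionProtocol.dY₁

variable {T}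

/-- `(W^{L,x} ⊗ W^{R,x}) (U^I ⊗ 1_{X₀X₁Y₀Y₁}) (V^L ⊗ V^{R,x})` as a linear map from `A₀A₁`. -/
def InteractionProtocol.operator {a b : ℕ} (P : T.InteractionProtocol a b) (x : T.Input) :
    Matrix ((T.A₀ × P.Z₀) × (T.A₁ × P.Z₁)) (T.A₀ × T.A₁) ℂ :=
  (P.WL x ⊗ₖ P.WR x) *
    (((P.UI : Matrix (Qubits a × Qubits b) (Qubits a × Qubits b) ℂ) ⊗ₖ
        (1 : Matrix ((P.X₀ × P.X₁) × (P.Y₀ × P.Y₁)) ((P.X₀ × P.X₁) × (P.Y₀ × P.Y₁)) ℂ)) *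
      (P.VL ⊗ₖ P.VR x).submatrix
        (fun p : (Qubits a × Qubits b) × ((P.X₀ × P.X₁) × (P.Y₀ × P.Y₁)) =>
          ((p.1.1, p.2.1), (p.1.2, p.2.2)))
        (fun s : T.A₀ × T.A₁ => (s, ()))).submatrix
      (fun p : (Qubits a × (P.X₀ × P.Y₀)) × (Qubits b × (P.X₁ × P.Y₁)) =>
        ((p.1.1, p.2.1), ((p.1.2.1, p.2.2.1), (p.1.2.2, p.2.2.2)))) id

/-- The channel on `A₀A₁` that the protocol implements on input `x`. -/
def InteractionProtocol.channel {a b : ℕ} (P : T.InteractionProtocol a b) (x : T.Input) :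
    SuperOp (T.A₀ × T.A₁) (T.A₀ × T.A₁) :=
  fun ρ => traceOutZ (conjBy (P.operator x) ρ)

variable (T)

/-- The `ε`-approximate interaction class of the task, restricted to unitaries on `a + b` qubits, of
which `a` come from the left and `b` from the right. -/
def interactionClass (ε : ℝ) (a b : ℕ) : Set (Matrix.unitaryGroup (Qubits a × Qubits b) ℂ) :=
  {UI | ∃ P : T.InteractionProtocol a b, P.UI = UI ∧ ∀ x,
    diamondNorm (conjBy (T.U x : Matrix (T.A₀ × T.A₁) (T.A₀ × T.A₁) ℂ) - P.channel x)
      ≤ ENNReal.ofReal ε}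

/-- `n'`: the minimal number of qubits brought into an interaction unitary, over the
`ε`-approximate interaction class of the task (`⊤` if that class is empty). -/
def minInteractionQubits (ε : ℝ) : ℕ∞ :=
  ⨅ (a : ℕ) (b : ℕ) (_ : (T.interactionClass ε a b).Nonempty), ((a + b : ℕ) : ℕ∞)

end OneSidedTask

end

/-!
The theorem is proved by port-based teleportation. Let a non-local protocol with `E` EPR pairs be
given, and let `d = 2 ^ E` be the dimension of the halves `V₀`, `V₁` of the entangled state. Without
shared entanglement, the left can create this state itself and apply its isometry to the input and
`V₀`; what is missing is that `V₁` is processed by the isometry of the right, which depends on `x` and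
whose outputs may be arbitrarily large. The right therefore prepares `N` maximally entangled pairs
`A_j B_j` (the ports), applies its isometry to each `B_j` and sends the resulting messages, for all
`j`, to both sides. Only `V₁` and the `A_j` enter the interaction, which has to teleport `V₁` into one
of the `B_j` and to tell both sides the index `j`; they then continue with the messages of this port
and discard the others.

The ideal measurement is `M = (d / √N) ∑ i, |i⟩|i⟩ ⊗ Φ_i`, where `Φ_i` projects `V₁A_i` onto the
maximally entangled state (`portMeasurement`). With `M` in place of the interaction unitary the
resulting channel would be exactly that of the non-local protocol
(`interact_selectPort_portMeasurement`, `traceOutZ_conjBy_of_eq_mul`). It is not an isometry, but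
`G = M† M = (d² / N) ∑ i, Φ_i` is close to `1` on the states that occur: these are maximally mixed on
the ports, and there the operators `Φ_i` behave like pairwise uncorrelated random variables, so that
`(1 - G)²` has expectation exactly `(d² - 1) / N` (`portTrace_one_sub_gram_sq`), whatever the input.
The unitary part `U` of the polar decomposition of `M` satisfies `(U - M)† (U - M) ≤ (1 - G)²`
(`Matrix.exists_unitary_near`). Hence the Stinespring operators differ by at most `√((d² - 1) / N)` in
operator norm, and the channels by at most twice this in diamond norm
(`diamondNorm_traceOutZ_sub_le`).

For the last step the trace norm, defined through singular values, is characterized by its duality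
with the operator norm (`norm_trace_mul_le`, `exists_unitary_trace_mul_eq_traceNorm`).

Since `d² = 4 ^ E`, it suffices to take `N = 2 ^ (2 E + k)` ports with `k` depending on `ε - δ` only,
which is `E + N E + O(E + k)` qubits, well below the bound `2 ^ (8 E)`.
-/

open scoped Matrix Kronecker ENNReal

noncomputable section

/-! ### Polar decomposition and the trace norm -/

section TraceNorm

open scoped Matrix.Norms.L2Operator MatrixOrder ComplexOrder

variable {n m : Type*} [Fintype n] [DecidableEq n] [Fintype m]

/-- A matrix with orthogonal columns is a unitary times a nonnegative diagonal matrix: normalize the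
nonzero columns and extend them to an orthonormal basis. -/
theorem Matrix.exists_unitary_mul_diagonal_sqrt (B : Matrix n n ℂ) (r : n → ℝ)
    (hr : ∀ i, 0 ≤ r i) (hB : Bᴴ * B = Matrix.diagonal fun i => (r i : ℂ)) :
    ∃ Q ∈ Matrix.unitaryGroup n ℂ, B = Q * Matrix.diagonal fun i => ((√(r i) : ℝ) : ℂ) := by
  have hin : ∀ i j, ∑ k, star (B k i) * B k j = if i = j then (r i : ℂ) else 0 := by
    intro i j
    have := congrFun (congrFun hB i) j
    simpa [Matrix.mul_apply, Matrix.diagonal_apply] using this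
  let v : n → EuclideanSpace ℂ n := fun i => WithLp.toLp 2 fun k => ((√(r i) : ℝ) : ℂ)⁻¹ * B k i
  let s : Set n := {i | r i ≠ 0}
  have hv : Orthonormal ℂ (s.domRestrict v) := by
    rw [orthonormal_iff_ite]
    rintro ⟨i, hi⟩ ⟨j, hj⟩
    have hsi : ((√(r i) : ℝ) : ℂ) ≠ 0 := by
      rw [Complex.ofReal_ne_zero]; exact (Real.sqrt_ne_zero (hr i)).2 hi
    have : inner ℂ (v i) (v j)
        = ((√(r i) : ℝ) : ℂ)⁻¹ * ((√(r j) : ℝ) : ℂ)⁻¹ * ∑ k, star (B k i) * B k j := by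
      simp only [v, PiLp.inner_apply, RCLike.inner_apply, Finset.mul_sum, map_mul, map_inv₀,
        Complex.conj_ofReal]
      refine Finset.sum_congr rfl fun k _ => ?_
      simp only [RCLike.star_def]; ring
    rw [Set.domRestrict_apply, Set.domRestrict_apply, this, hin]
    simp only [Subtype.mk.injEq]
    split_ifs with h
    · subst h
      have : (r i : ℂ) = ((√(r i) : ℝ) : ℂ) * ((√(r i) : ℝ) : ℂ) := by
        rw [← Complex.ofReal_mul, Real.mul_self_sqrt (hr i)]
      rw [this]; field_simp
    · simp
  obtain ⟨b, hb⟩ := hv.exists_orthonormalBasis_extension_of_card_eq (by simp)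
  refine ⟨Matrix.of fun k i => b i k, ?_, ?_⟩
  · rw [Matrix.mem_unitaryGroup_iff']
    ext i j
    have := orthonormal_iff_ite.1 b.orthonormal i j
    rw [Matrix.one_apply, ← this]
    simp [Matrix.mul_apply, PiLp.inner_apply, Matrix.star_eq_conjTranspose, mul_comm]
  · ext k i
    rw [Matrix.mul_diagonal, Matrix.of_apply]
    by_cases hi : r i = 0
    · have h0 : ∑ k, ‖B k i‖ ^ 2 = 0 := by
        have := hin i i
        rw [if_pos rfl, hi] at this
        have h2 : ((∑ k, ‖B k i‖ ^ 2 : ℝ) : ℂ) = 0 := by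
          push_cast
          rw [Complex.ofReal_zero] at this
          rw [← this]
          refine Finset.sum_congr rfl fun k _ => ?_
          rw [RCLike.star_def, Complex.conj_mul']
        exact_mod_cast h2
      have := (Finset.sum_eq_zero_iff_of_nonneg (fun k _ => by positivity)).1 h0 k (Finset.mem_univ k)
      have : B k i = 0 := by simpa using this
      simp [this, hi]
    · have hsi : ((√(r i) : ℝ) : ℂ) ≠ 0 := by
        rw [Complex.ofReal_ne_zero]; exact (Real.sqrt_ne_zero (hr i)).2 hi
      rw [hb i hi]
      simp only [v]
      field_simp

/-- Polar decomposition of a square matrix, with a unitary (not only a partial isometry) as its first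
factor. The trace of the positive factor is the trace norm. -/
theorem Matrix.exists_polar_decomposition (A : Matrix n n ℂ) :
    ∃ U ∈ Matrix.unitaryGroup n ℂ, ∃ P : Matrix n n ℂ, P.PosSemidef ∧ A = U * P ∧
      P.trace = (traceNorm A : ℂ) := by
  set hA := Matrix.isHermitian_conjTranspose_mul_self A with hA_def
  let V : Matrix n n ℂ := hA.eigenvectorUnitary
  have hV1 : Vᴴ * V = 1 := Matrix.mem_unitaryGroup_iff'.1 hA.eigenvectorUnitary.2
  have hV2 : V * Vᴴ = 1 := Matrix.mem_unitaryGroup_iff.1 hA.eigenvectorUnitary.2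
  have hspec : Aᴴ * A = V * Matrix.diagonal (fun i => (hA.eigenvalues i : ℂ)) * Vᴴ := by
    have := hA.spectral_theorem
    rw [Unitary.conjStarAlgAut_apply] at this
    exact this
  have hnn : ∀ i, 0 ≤ hA.eigenvalues i := fun i =>
    Matrix.eigenvalues_conjTranspose_mul_self_nonneg A i
  obtain ⟨Q, hQ, hAQ⟩ := Matrix.exists_unitary_mul_diagonal_sqrt (A * V) hA.eigenvalues hnn (by
    rw [Matrix.conjTranspose_mul]
    calc Vᴴ * Aᴴ * (A * V) = Vᴴ * (Aᴴ * A) * V := by simp only [Matrix.mul_assoc]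
      _ = (Vᴴ * V) * Matrix.diagonal (fun i => (hA.eigenvalues i : ℂ)) * (Vᴴ * V) := by
        conv_lhs => rw [hspec]
        simp only [Matrix.mul_assoc]
      _ = _ := by rw [hV1]; simp)
  set R : Matrix n n ℂ := Matrix.diagonal fun i => ((√(hA.eigenvalues i) : ℝ) : ℂ) with hR
  have hRpos : R.PosSemidef := by
    rw [hR, Matrix.posSemidef_diagonal_iff]
    intro i
    exact_mod_cast Real.sqrt_nonneg _
  refine ⟨Q * Vᴴ, ?_, V * R * Vᴴ, hRpos.mul_mul_conjTranspose_same V, ?_, ?_⟩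
  · exact mul_mem hQ ((star hA.eigenvectorUnitary).2)
  · calc A = A * V * Vᴴ := by rw [Matrix.mul_assoc, hV2, Matrix.mul_one]
      _ = Q * R * Vᴴ := by rw [hAQ]
      _ = Q * ((Vᴴ * V) * R * Vᴴ) := by rw [hV1]; simp [Matrix.mul_assoc]
      _ = _ := by simp only [Matrix.mul_assoc]
  · rw [Matrix.trace_mul_comm, ← Matrix.mul_assoc, hV1, Matrix.one_mul, hR, Matrix.trace_diagonal,
      traceNorm]
    push_cast
    rfl

theorem Matrix.norm_le_one_of_isometry {V : Matrix m n ℂ} (hV : Vᴴ * V = 1) : ‖V‖ ≤ 1 := by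
  have h := Matrix.l2_opNorm_conjTranspose_mul_self V
  have h1 : ‖(1 : Matrix n n ℂ)‖ ≤ 1 := by
    rw [← Matrix.diagonal_one, Matrix.l2_opNorm_diagonal]
    exact (pi_norm_le_iff_of_nonneg zero_le_one).2 fun i => by simp
  rw [hV] at h
  nlinarith [norm_nonneg V]

/-- The trace norm is attained in the duality with the operator norm. -/
theorem exists_unitary_trace_mul_eq_traceNorm (A : Matrix n n ℂ) :
    ∃ W ∈ Matrix.unitaryGroup n ℂ, (W * A).trace = (traceNorm A : ℂ) := by
  obtain ⟨U, hU, P, -, hA, hP⟩ := Matrix.exists_polar_decomposition A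
  refine ⟨star U, (star (⟨U, hU⟩ : Matrix.unitaryGroup n ℂ)).2, ?_⟩
  rw [← hP]
  nth_rw 1 [hA]
  rw [← Matrix.mul_assoc, Matrix.mem_unitaryGroup_iff'.1 hU, Matrix.one_mul]

/-- The trace norm is dual to the operator norm. -/
theorem norm_trace_mul_le (W A : Matrix n n ℂ) : ‖(W * A).trace‖ ≤ ‖W‖ * traceNorm A := by
  set hA := Matrix.isHermitian_conjTranspose_mul_self A with hA_def
  let b := hA.eigenvectorBasis
  -- the trace is computed in the eigenbasis of `Aᴴ * A`
  have htr : (W * A).trace = ∑ i, inner ℂ (b i) (Matrix.toLpLin 2 2 (W * A) (b i)) := by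
    rw [← LinearMap.trace_eq_sum_inner _ b, Matrix.toLpLin_eq_toLin,
      LinearMap.trace_eq_matrix_trace ℂ (PiLp.basisFun 2 ℂ n), LinearMap.toMatrix_toLin]
  have hnorm : ∀ i, ‖WithLp.toLp 2 (A *ᵥ (b i).ofLp)‖ = √(hA.eigenvalues i) := by
    intro i
    have h1 : (Aᴴ * A) *ᵥ (b i).ofLp = hA.eigenvalues i • (b i).ofLp := hA.mulVec_eigenvectorBasis i
    rw [EuclideanSpace.norm_eq]
    congr 1
    have h2 : star (b i).ofLp ⬝ᵥ ((Aᴴ * A) *ᵥ (b i).ofLp)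
        = ((∑ j, ‖(A *ᵥ (b i).ofLp) j‖ ^ 2 : ℝ) : ℂ) := by
      rw [← Matrix.mulVec_mulVec, Matrix.dotProduct_mulVec, ← Matrix.star_mulVec]
      simp [dotProduct, Complex.conj_mul']
    have h3 : star (b i).ofLp ⬝ᵥ (b i).ofLp = 1 := by
      have := orthonormal_iff_ite.1 b.orthonormal i i
      rw [if_pos rfl, PiLp.inner_apply] at this
      rw [← this]
      simp [dotProduct, Complex.conj_mul']
    rw [h1, dotProduct_smul, h3] at h2
    have h4 : ((hA.eigenvalues i : ℝ) : ℂ) = ((∑ j, ‖(A *ᵥ (b i).ofLp) j‖ ^ 2 : ℝ) : ℂ) := by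
      rw [← h2]; simp
    exact (Complex.ofReal_injective h4).symm
  rw [htr, traceNorm, Finset.mul_sum]
  refine (norm_sum_le _ _).trans (Finset.sum_le_sum fun i _ => ?_)
  refine (norm_inner_le_norm _ _).trans ?_
  rw [b.norm_eq_one, one_mul, ← hnorm i]
  have : Matrix.toLpLin 2 2 (W * A) (b i)
      = WithLp.toLp 2 (W *ᵥ (WithLp.toLp 2 (A *ᵥ (b i).ofLp) : EuclideanSpace ℂ n).ofLp) := by
    rw [Matrix.toLpLin_apply, Matrix.mulVec_mulVec]
  rw [this]
  exact Matrix.l2_opNorm_mulVec W _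

theorem traceNorm_le_of_forall_unitary {A : Matrix n n ℂ} {c : ℝ}
    (h : ∀ W ∈ Matrix.unitaryGroup n ℂ, ‖(W * A).trace‖ ≤ c) : traceNorm A ≤ c := by
  obtain ⟨W, hW, hWA⟩ := exists_unitary_trace_mul_eq_traceNorm A
  have := h W hW
  rw [hWA, Complex.norm_real] at this
  exact (le_abs_self _).trans this

theorem traceNorm_add_le (A B : Matrix n n ℂ) : traceNorm (A + B) ≤ traceNorm A + traceNorm B := by
  have hle : ∀ W ∈ Matrix.unitaryGroup n ℂ, ∀ C : Matrix n n ℂ, ‖(W * C).trace‖ ≤ traceNorm C := by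
    intro W hW C
    refine (norm_trace_mul_le W C).trans ?_
    have hC : 0 ≤ traceNorm C := Finset.sum_nonneg fun i _ => Real.sqrt_nonneg _
    exact mul_le_of_le_one_left hC
      (Matrix.norm_le_one_of_isometry (Matrix.mem_unitaryGroup_iff'.1 hW))
  refine traceNorm_le_of_forall_unitary fun W hW => ?_
  rw [Matrix.mul_add, Matrix.trace_add]
  exact (norm_add_le _ _).trans (add_le_add (hle W hW A) (hle W hW B))

theorem Matrix.norm_le_of_posSemidef_sub {M : Matrix m n ℂ} {c : ℝ} (hc : 0 ≤ c)
    (h : (((c ^ 2 : ℝ) : ℂ) • (1 : Matrix n n ℂ) - Mᴴ * M).PosSemidef) : ‖M‖ ≤ c := by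
  have h0 : (0 : Matrix n n ℂ) ≤ Mᴴ * M :=
    Matrix.nonneg_iff_posSemidef.2 (Matrix.posSemidef_conjTranspose_mul_self M)
  have h1 := CStarAlgebra.norm_le_norm_of_nonneg_of_le h0 (Matrix.le_iff.2 h)
  have h2 : ‖((c ^ 2 : ℝ) : ℂ) • (1 : Matrix n n ℂ)‖ ≤ c ^ 2 := by
    rw [norm_smul, Complex.norm_real, Real.norm_of_nonneg (sq_nonneg c)]
    exact mul_le_of_le_one_right (sq_nonneg c) (Matrix.norm_le_one_of_isometry (by simp))
  rw [Matrix.l2_opNorm_conjTranspose_mul_self] at h1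
  exact abs_le_of_sq_le_sq' (by nlinarith) hc |>.2

theorem Matrix.norm_kronecker_one_le [DecidableEq m] {k : Type*} [Fintype k] [DecidableEq k]
    (M : Matrix m n ℂ) :
    ‖M ⊗ₖ (1 : Matrix k k ℂ)‖ ≤ ‖M‖ := by
  refine Matrix.norm_le_of_posSemidef_sub (norm_nonneg M) ?_
  have h1 : (((‖M‖ ^ 2 : ℝ) : ℂ) • (1 : Matrix n n ℂ) - Mᴴ * M).PosSemidef := by
    rw [← Matrix.le_iff]
    have h2 := (Matrix.isHermitian_conjTranspose_mul_self M).isSelfAdjoint.le_algebraMap_norm_self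
    rw [Matrix.l2_opNorm_conjTranspose_mul_self, ← sq] at h2
    refine h2.trans_eq ?_
    rw [Algebra.algebraMap_eq_smul_one]
    ext i j; simp
  have h2 := h1.kronecker (Matrix.PosSemidef.one (n := k) (R := ℂ))
  suffices h : ((‖M‖ ^ 2 : ℝ) : ℂ) • (1 : Matrix (n × k) (n × k) ℂ)
      - (M ⊗ₖ (1 : Matrix k k ℂ))ᴴ * (M ⊗ₖ (1 : Matrix k k ℂ))
      = (((‖M‖ ^ 2 : ℝ) : ℂ) • (1 : Matrix n n ℂ) - Mᴴ * M) ⊗ₖ (1 : Matrix k k ℂ) by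
    rw [h]; exact h2
  rw [Matrix.conjTranspose_kronecker, ← Matrix.mul_kronecker_mul, Matrix.conjTranspose_one,
    Matrix.mul_one, sub_eq_add_neg, sub_eq_add_neg, Matrix.add_kronecker, Matrix.smul_kronecker,
    Matrix.one_kronecker_one, ← neg_one_smul ℂ (Mᴴ * M), Matrix.smul_kronecker, neg_one_smul]

/-- The unitary part `U` of the polar decomposition of `M` is as close to `M` as `M` is to an
isometry: in the polar decomposition `M = U * P` the claim is `(1 - P)² ≤ (1 - P²)²`. -/
theorem Matrix.exists_unitary_near (M : Matrix n n ℂ) :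
    ∃ U ∈ Matrix.unitaryGroup n ℂ,
      ((1 - Mᴴ * M) * (1 - Mᴴ * M) - (U - M)ᴴ * (U - M)).PosSemidef := by
  obtain ⟨U, hU, P, hP, hM, -⟩ := Matrix.exists_polar_decomposition M
  have hUU : Uᴴ * U = 1 := Matrix.mem_unitaryGroup_iff'.1 hU
  have hPP : Pᴴ = P := hP.1
  refine ⟨U, hU, ?_⟩
  have h1 : Mᴴ * M = P * P := by
    rw [hM, Matrix.conjTranspose_mul, hPP]
    calc P * Uᴴ * (U * P) = P * (Uᴴ * U) * P := by simp only [Matrix.mul_assoc]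
      _ = P * P := by rw [hUU, Matrix.mul_one]
  have h2 : (U - M)ᴴ * (U - M) = (1 - P) * (1 - P) := by
    have : U - M = U * (1 - P) := by rw [hM, Matrix.mul_sub, Matrix.mul_one]
    rw [this, Matrix.conjTranspose_mul, Matrix.conjTranspose_sub, Matrix.conjTranspose_one, hPP]
    calc (1 - P) * Uᴴ * (U * (1 - P)) = (1 - P) * (Uᴴ * U) * (1 - P) := by
          simp only [Matrix.mul_assoc]
      _ = _ := by rw [hUU, Matrix.mul_one]
  have hQ : (1 - P)ᴴ = 1 - P := by rw [Matrix.conjTranspose_sub, Matrix.conjTranspose_one, hPP]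
  have h3 := (hP.add hP).mul_mul_conjTranspose_same (1 - P)
  have h4 := Matrix.posSemidef_conjTranspose_mul_self (P * (1 - P))
  rw [Matrix.conjTranspose_mul, hPP] at h4
  rw [hQ] at h3 h4
  have h5 := h3.add h4
  rw [h1, h2]
  convert h5 using 1
  noncomm_ring

end TraceNorm

/-! ### The diamond norm and Stinespring operators -/

section DiamondNorm

open scoped Matrix.Norms.L2Operator

theorem SuperOp.tensorId_sub {ι κ : Type*} (Φ Ψ : SuperOp ι κ) (k : ℕ)
    (X : Matrix (ι × Fin k) (ι × Fin k) ℂ) :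
    SuperOp.tensorId (Φ - Ψ) k X = Φ.tensorId k X - Ψ.tensorId k X := rfl

theorem diamondNorm_sub_le {ι κ : Type*} [Fintype ι] [DecidableEq ι] [Fintype κ] [DecidableEq κ]
    (Φ Ψ Ω : SuperOp ι κ) :
    diamondNorm (Φ - Ω) ≤ diamondNorm (Φ - Ψ) + diamondNorm (Ψ - Ω) := by
  refine iSup_le fun k => iSup_le fun X => iSup_le fun hX => ?_
  have h : SuperOp.tensorId (Φ - Ω) k X
      = SuperOp.tensorId (Φ - Ψ) k X + SuperOp.tensorId (Ψ - Ω) k X := by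
    simp only [SuperOp.tensorId_sub]; abel
  rw [h]
  refine (ENNReal.ofReal_le_ofReal (traceNorm_add_le _ _)).trans
    (ENNReal.ofReal_add_le.trans (add_le_add ?_ ?_))
  · exact le_iSup_of_le k (le_iSup_of_le X (le_iSup_of_le hX le_rfl))
  · exact le_iSup_of_le k (le_iSup_of_le X (le_iSup_of_le hX le_rfl))

theorem tensorId_conjBy {ι κ : Type*} [Fintype ι] [DecidableEq ι] [DecidableEq κ]
    (M : Matrix κ ι ℂ) (k : ℕ) (X : Matrix (ι × Fin k) (ι × Fin k) ℂ) :
    SuperOp.tensorId (conjBy M) k X = (M ⊗ₖ (1 : Matrix (Fin k) (Fin k) ℂ)) * X *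
      (M ⊗ₖ (1 : Matrix (Fin k) (Fin k) ℂ))ᴴ := by
  ext p q
  simp only [SuperOp.tensorId, conjBy, Matrix.of_apply, Matrix.mul_apply, Fintype.sum_prod_type,
    Matrix.kroneckerMap_apply, Matrix.conjTranspose_apply, Matrix.one_apply, mul_ite, mul_one,
    mul_zero, ite_mul, zero_mul, Finset.sum_ite_eq, Finset.mem_univ, if_true]
  refine Finset.sum_congr rfl fun j _ => ?_
  simp [apply_ite star]

variable {ι A₀ A₁ Z₀ Z₁ : Type*} [Fintype A₀] [Fintype A₁] [Fintype Z₀] [DecidableEq Z₀]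
  [Fintype Z₁] [DecidableEq Z₁]

/-- Separates the systems `Z₀Z₁` that are traced out from the other ones. -/
def splitZ (A₀ A₁ Z₀ Z₁ : Type*) (k : ℕ) :
    (((A₀ × Z₀) × (A₁ × Z₁)) × Fin k) ≃ (((A₀ × A₁) × Fin k) × (Z₀ × Z₁)) where
  toFun p := (((p.1.1.1, p.1.2.1), p.2), (p.1.1.2, p.1.2.2))
  invFun p := (((p.1.1.1, p.2.1), (p.1.1.2, p.2.2)), p.1.2)
  left_inv _ := rfl
  right_inv _ := rfl

/-- The observable `W ⊗ 1_{Z₀Z₁}` on the system from which `Z₀` and `Z₁` have not yet been traced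
out. -/
def liftZ (Z₀ Z₁ : Type*) [DecidableEq Z₀] [DecidableEq Z₁] {k : ℕ}
    (W : Matrix ((A₀ × A₁) × Fin k) ((A₀ × A₁) × Fin k) ℂ) :
    Matrix (((A₀ × Z₀) × (A₁ × Z₁)) × Fin k) (((A₀ × Z₀) × (A₁ × Z₁)) × Fin k) ℂ :=
  (W ⊗ₖ (1 : Matrix (Z₀ × Z₁) (Z₀ × Z₁) ℂ)).submatrix (splitZ A₀ A₁ Z₀ Z₁ k) (splitZ A₀ A₁ Z₀ Z₁ k)

/-- `W ↦ W ⊗ 1_{Z₀Z₁}` is adjoint to the partial trace. -/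
theorem trace_mul_tensorId_traceOutZ {k : ℕ} (Φ : SuperOp ι ((A₀ × Z₀) × (A₁ × Z₁)))
    (W : Matrix ((A₀ × A₁) × Fin k) ((A₀ × A₁) × Fin k) ℂ)
    (X : Matrix (ι × Fin k) (ι × Fin k) ℂ) :
    (W * SuperOp.tensorId (fun ρ => traceOutZ (Φ ρ)) k X).trace
      = (liftZ Z₀ Z₁ W * SuperOp.tensorId Φ k X).trace := by
  set Y := SuperOp.tensorId Φ k X with hY
  have hT : SuperOp.tensorId (fun ρ => traceOutZ (Φ ρ)) k X = Matrix.of fun p q =>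
      ∑ z : Z₀ × Z₁, Y ((splitZ A₀ A₁ Z₀ Z₁ k).symm (p, z)) ((splitZ A₀ A₁ Z₀ Z₁ k).symm (q, z)) := by
    ext p q
    simp only [Fintype.sum_prod_type]
    rfl
  simp only [hT, Matrix.trace, Matrix.diag_apply, Matrix.mul_apply, Matrix.of_apply]
  rw [← (splitZ A₀ A₁ Z₀ Z₁ k).symm.sum_comp,
    Fintype.sum_prod_type (α₁ := (A₀ × A₁) × Fin k) (α₂ := Z₀ × Z₁)]
  refine Fintype.sum_congr _ _ fun p => ?_
  refine Eq.trans ?_ (Finset.sum_congr rfl fun z _ => (splitZ A₀ A₁ Z₀ Z₁ k).symm.sum_comp _)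
  simp_rw [Finset.mul_sum]
  rw [Finset.sum_comm]
  refine Finset.sum_congr rfl fun z _ => ?_
  rw [Fintype.sum_prod_type (α₁ := (A₀ × A₁) × Fin k) (α₂ := Z₀ × Z₁)]
  refine Fintype.sum_congr _ _ fun q => ?_
  simp [liftZ, Matrix.one_apply]

variable [Fintype ι] [DecidableEq ι] [DecidableEq A₀] [DecidableEq A₁]

theorem liftZ_isometry {k : ℕ} {W : Matrix ((A₀ × A₁) × Fin k) ((A₀ × A₁) × Fin k) ℂ}
    (hW : Wᴴ * W = 1) : (liftZ Z₀ Z₁ W)ᴴ * liftZ Z₀ Z₁ W = 1 := by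
  rw [liftZ, Matrix.conjTranspose_submatrix, Matrix.submatrix_mul_equiv,
    Matrix.conjTranspose_kronecker, ← Matrix.mul_kronecker_mul, hW]
  simp

/-- Channels with nearby Stinespring operators are close in diamond norm. By duality this is the bound
`‖M† L M - N† L N‖ ≤ 2 ‖M - N‖` for the observables `L = W ⊗ 1_{Z₀Z₁}`. -/
theorem diamondNorm_traceOutZ_sub_le
    {M N : Matrix ((A₀ × Z₀) × (A₁ × Z₁)) ι ℂ} {η : ℝ} (hη : 0 ≤ η) (hM : ‖M‖ ≤ 1) (hN : ‖N‖ ≤ 1)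
    (hMN : ‖M - N‖ ≤ η) :
    diamondNorm ((fun ρ => traceOutZ (conjBy M ρ) : SuperOp ι (A₀ × A₁))
      - (fun ρ => traceOutZ (conjBy N ρ))) ≤ ENNReal.ofReal (2 * η) := by
  refine iSup_le fun k => iSup_le fun X => iSup_le fun hX => ENNReal.ofReal_le_ofReal ?_
  refine traceNorm_le_of_forall_unitary fun W hW => ?_
  rw [SuperOp.tensorId_sub, Matrix.mul_sub, Matrix.trace_sub, trace_mul_tensorId_traceOutZ,
    trace_mul_tensorId_traceOutZ, tensorId_conjBy, tensorId_conjBy]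
  set L := liftZ Z₀ Z₁ W with hL
  have hLn : ‖L‖ ≤ 1 := Matrix.norm_le_one_of_isometry
    (liftZ_isometry (Matrix.mem_unitaryGroup_iff'.1 hW))
  set M' := M ⊗ₖ (1 : Matrix (Fin k) (Fin k) ℂ) with hM'
  set N' := N ⊗ₖ (1 : Matrix (Fin k) (Fin k) ℂ) with hN'
  have hMn : ‖M'‖ ≤ 1 := (Matrix.norm_kronecker_one_le M).trans hM
  have hNn : ‖N'‖ ≤ 1 := (Matrix.norm_kronecker_one_le N).trans hN
  have hD : ‖M' - N'‖ ≤ η := by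
    have : M' - N' = (M - N) ⊗ₖ (1 : Matrix (Fin k) (Fin k) ℂ) := by
      ext p q; simp [hM', hN', sub_mul]
    rw [this]
    exact (Matrix.norm_kronecker_one_le _).trans hMN
  -- `M† L M - N† L N = (M - N)† L M + N† L (M - N)`, tested against the operator `X`
  have h1 : (L * (M' * X * M'ᴴ)).trace - (L * (N' * X * N'ᴴ)).trace
      = (((M' - N')ᴴ * (L * M') + N'ᴴ * (L * (M' - N'))) * X).trace := by
    have hc : ∀ K : Matrix (((A₀ × Z₀) × (A₁ × Z₁)) × Fin k) (ι × Fin k) ℂ,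
        (L * (K * X * Kᴴ)).trace = (Kᴴ * (L * K) * X).trace := by
      intro K
      rw [← Matrix.mul_assoc, Matrix.trace_mul_comm]
      simp only [Matrix.mul_assoc]
    rw [hc, hc, ← Matrix.trace_sub, ← Matrix.sub_mul]
    congr 2
    rw [Matrix.conjTranspose_sub]
    simp only [Matrix.mul_sub, Matrix.sub_mul]
    abel
  rw [h1]
  have hp : ∀ {a b : ℝ}, 0 ≤ a → a ≤ 1 → b ≤ η → b * a ≤ η := fun h0 h1 h2 =>
    (mul_le_mul_of_nonneg_right h2 h0).trans (mul_le_of_le_one_right hη h1)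
  have h2 : ‖(M' - N')ᴴ * (L * M') + N'ᴴ * (L * (M' - N'))‖ ≤ 2 * η := by
    refine (norm_add_le _ _).trans ?_
    have hLM : ‖L * M'‖ ≤ 1 := (Matrix.l2_opNorm_mul _ _).trans (mul_le_one₀ hLn (norm_nonneg _) hMn)
    have ha : ‖(M' - N')ᴴ * (L * M')‖ ≤ η := by
      refine (Matrix.l2_opNorm_mul _ _).trans ?_
      rw [Matrix.l2_opNorm_conjTranspose]
      exact hp (norm_nonneg _) hLM hD
    have hb : ‖N'ᴴ * (L * (M' - N'))‖ ≤ η := by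
      refine (Matrix.l2_opNorm_mul _ _).trans ?_
      rw [Matrix.l2_opNorm_conjTranspose, mul_comm]
      refine hp (norm_nonneg _) hNn ((Matrix.l2_opNorm_mul _ _).trans ?_)
      rw [mul_comm]
      exact hp (norm_nonneg _) hLn hD
    linarith
  refine (norm_trace_mul_le _ _).trans ?_
  have hX0 : 0 ≤ traceNorm X := Finset.sum_nonneg fun i _ => Real.sqrt_nonneg _
  exact (mul_le_mul_of_nonneg_right h2 hX0).trans (mul_le_of_le_one_right (by positivity) hX)

end DiamondNorm

/-! ### Local protocols with an arbitrary interaction operator -/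

section Interact

variable {A₀ A₁ Z₀ Z₁ X₀ X₁ Y₀ Y₁ Q₀ Q₁ K₀ K₁ D₀ D₁ S : Type*}
  [Fintype X₀] [Fintype X₁] [Fintype Y₀] [Fintype Y₁] [Fintype Q₀] [Fintype Q₁] [Fintype K₀]
  [Fintype K₁] [Fintype D₀] [Fintype D₁]
  [DecidableEq X₀] [DecidableEq X₁] [DecidableEq Y₀] [DecidableEq Y₁]

/-- The state `V_L ⊗ V_R`, with the systems `D₀D₁` entering the interaction moved to the front. -/
def prepared (VL : Matrix (D₀ × (X₀ × X₁)) S ℂ) (VR : Matrix (D₁ × (Y₀ × Y₁)) Unit ℂ) :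
    Matrix ((D₀ × D₁) × ((X₀ × X₁) × (Y₀ × Y₁))) S ℂ :=
  (VL ⊗ₖ VR).submatrix (fun p => ((p.1.1, p.2.1), (p.1.2, p.2.2))) (fun s => (s, ()))

/-- The operator `(W_L ⊗ W_R) (B ⊗ 1) (V_L ⊗ V_R)` of a local protocol with an arbitrary operator
`B : D₀D₁ → Q₀Q₁` in place of the interaction unitary. -/
def interact (WL : Matrix (A₀ × Z₀) (Q₀ × (X₀ × Y₀)) ℂ) (WR : Matrix (A₁ × Z₁) (Q₁ × (X₁ × Y₁)) ℂ)
    (VL : Matrix (D₀ × (X₀ × X₁)) S ℂ) (VR : Matrix (D₁ × (Y₀ × Y₁)) Unit ℂ)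
    (B : Matrix (Q₀ × Q₁) (D₀ × D₁) ℂ) : Matrix ((A₀ × Z₀) × (A₁ × Z₁)) S ℂ :=
  (WL ⊗ₖ WR) *
    ((B ⊗ₖ (1 : Matrix ((X₀ × X₁) × (Y₀ × Y₁)) ((X₀ × X₁) × (Y₀ × Y₁)) ℂ)) *
      prepared VL VR).submatrix
      (fun p : (Q₀ × (X₀ × Y₀)) × (Q₁ × (X₁ × Y₁)) =>
        ((p.1.1, p.2.1), ((p.1.2.1, p.2.2.1), (p.1.2.2, p.2.2.2)))) id

theorem interact_sub (WL : Matrix (A₀ × Z₀) (Q₀ × (X₀ × Y₀)) ℂ)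
    (WR : Matrix (A₁ × Z₁) (Q₁ × (X₁ × Y₁)) ℂ)
    (VL : Matrix (D₀ × (X₀ × X₁)) S ℂ) (VR : Matrix (D₁ × (Y₀ × Y₁)) Unit ℂ)
    (B C : Matrix (Q₀ × Q₁) (D₀ × D₁) ℂ) :
    interact WL WR VL VR (B - C) = interact WL WR VL VR B - interact WL WR VL VR C := by
  have h : (B - C) ⊗ₖ (1 : Matrix ((X₀ × X₁) × (Y₀ × Y₁)) ((X₀ × X₁) × (Y₀ × Y₁)) ℂ)
      = B ⊗ₖ 1 - C ⊗ₖ 1 := by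
    ext p q; simp [sub_mul]
  rw [interact, h, Matrix.sub_mul, Matrix.submatrix_sub, Pi.sub_apply, Pi.sub_apply, Matrix.mul_sub]
  rfl

/-- Operators that the preparation applies, at its end, to the systems entering the interaction can be
counted as part of the interaction. -/
theorem interact_mul (WL : Matrix (A₀ × Z₀) (Q₀ × (X₀ × Y₀)) ℂ)
    (WR : Matrix (A₁ × Z₁) (Q₁ × (X₁ × Y₁)) ℂ)
    (VL : Matrix (D₀ × (X₀ × X₁)) S ℂ) (VR : Matrix (D₁ × (Y₀ × Y₁)) Unit ℂ)
    (B : Matrix (Q₀ × Q₁) (K₀ × K₁) ℂ) (J₀ : Matrix K₀ D₀ ℂ) (J₁ : Matrix K₁ D₁ ℂ) :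
    interact WL WR ((J₀ ⊗ₖ (1 : Matrix (X₀ × X₁) (X₀ × X₁) ℂ)) * VL)
      ((J₁ ⊗ₖ (1 : Matrix (Y₀ × Y₁) (Y₀ × Y₁) ℂ)) * VR) B
      = interact WL WR VL VR (B * (J₀ ⊗ₖ J₁)) := by
  have h : prepared ((J₀ ⊗ₖ (1 : Matrix (X₀ × X₁) (X₀ × X₁) ℂ)) * VL)
      ((J₁ ⊗ₖ (1 : Matrix (Y₀ × Y₁) (Y₀ × Y₁) ℂ)) * VR)
      = ((J₀ ⊗ₖ J₁) ⊗ₖ (1 : Matrix ((X₀ × X₁) × (Y₀ × Y₁)) ((X₀ × X₁) × (Y₀ × Y₁)) ℂ)) *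
        prepared VL VR := by
    rw [prepared, prepared, Matrix.mul_kronecker_mul,
      ← Matrix.submatrix_mul_equiv _ _ _ (Equiv.prodProdProdComm D₀ D₁ (X₀ × X₁) (Y₀ × Y₁))]
    congr 1
    ext p q
    simp only [Matrix.submatrix_apply, Matrix.kroneckerMap_apply, Equiv.prodProdProdComm_apply,
      ← Matrix.one_kronecker_one]
    ring
  rw [interact, interact, h, ← Matrix.mul_assoc, ← Matrix.mul_kronecker_mul, Matrix.mul_one]

/-- The Gram matrix of the operator of a local protocol depends only on that of the interaction. -/
theorem gram_interact [Fintype A₀] [Fintype A₁] [Fintype Z₀] [Fintype Z₁] [DecidableEq Q₀]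
    [DecidableEq Q₁] {WL : Matrix (A₀ × Z₀) (Q₀ × (X₀ × Y₀)) ℂ}
    {WR : Matrix (A₁ × Z₁) (Q₁ × (X₁ × Y₁)) ℂ} (hWL : WLᴴ * WL = 1) (hWR : WRᴴ * WR = 1)
    (VL : Matrix (D₀ × (X₀ × X₁)) S ℂ) (VR : Matrix (D₁ × (Y₀ × Y₁)) Unit ℂ)
    (B : Matrix (Q₀ × Q₁) (D₀ × D₁) ℂ) :
    (interact WL WR VL VR B)ᴴ * interact WL WR VL VR B = (prepared VL VR)ᴴ *
      ((Bᴴ * B) ⊗ₖ (1 : Matrix ((X₀ × X₁) × (Y₀ × Y₁)) ((X₀ × X₁) × (Y₀ × Y₁)) ℂ)) *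
        prepared VL VR := by
  let e : (Q₀ × (X₀ × Y₀)) × (Q₁ × (X₁ × Y₁)) ≃ (Q₀ × Q₁) × ((X₀ × X₁) × (Y₀ × Y₁)) :=
    { toFun := fun p => ((p.1.1, p.2.1), ((p.1.2.1, p.2.2.1), (p.1.2.2, p.2.2.2)))
      invFun := fun p => ((p.1.1, (p.2.1.1, p.2.2.1)), (p.1.2, (p.2.1.2, p.2.2.2)))
      left_inv := fun _ => rfl
      right_inv := fun _ => rfl }
  have hi : interact WL WR VL VR B = (WL ⊗ₖ WR) *
    ((B ⊗ₖ (1 : Matrix ((X₀ × X₁) × (Y₀ × Y₁)) ((X₀ × X₁) × (Y₀ × Y₁)) ℂ)) *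
      prepared VL VR).submatrix e id := rfl
  have hW : (WL ⊗ₖ WR)ᴴ * (WL ⊗ₖ WR) = 1 := by
    rw [Matrix.conjTranspose_kronecker, ← Matrix.mul_kronecker_mul, hWL, hWR,
      Matrix.one_kronecker_one]
  rw [hi, Matrix.conjTranspose_mul]
  set F := (B ⊗ₖ (1 : Matrix ((X₀ × X₁) × (Y₀ × Y₁)) ((X₀ × X₁) × (Y₀ × Y₁)) ℂ)) * prepared VL VR
    with hF
  calc (F.submatrix e id)ᴴ * (WL ⊗ₖ WR)ᴴ * ((WL ⊗ₖ WR) * F.submatrix e id)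
      = (F.submatrix e id)ᴴ * ((WL ⊗ₖ WR)ᴴ * (WL ⊗ₖ WR)) * F.submatrix e id := by
        simp only [Matrix.mul_assoc]
    _ = Fᴴ * F := by
        rw [hW, Matrix.mul_one, Matrix.conjTranspose_submatrix, Matrix.submatrix_mul_equiv,
          Matrix.submatrix_id_id]
    _ = _ := by
        rw [hF, Matrix.conjTranspose_mul, Matrix.conjTranspose_kronecker, Matrix.conjTranspose_one]
        have : (Bᴴ * B) ⊗ₖ (1 : Matrix ((X₀ × X₁) × (Y₀ × Y₁)) ((X₀ × X₁) × (Y₀ × Y₁)) ℂ)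
            = (Bᴴ ⊗ₖ (1 : Matrix ((X₀ × X₁) × (Y₀ × Y₁)) ((X₀ × X₁) × (Y₀ × Y₁)) ℂ)) *
              (B ⊗ₖ (1 : Matrix ((X₀ × X₁) × (Y₀ × Y₁)) ((X₀ × X₁) × (Y₀ × Y₁)) ℂ)) := by
          rw [← Matrix.mul_kronecker_mul, Matrix.mul_one]
        rw [this]
        simp only [Matrix.mul_assoc]

/-- If the reduced state of the right on `D₁` is maximally mixed, then the expectation of an
observable on `D₀D₁` whose partial trace over `D₁` is a multiple of the identity does not depend on
the input. -/
theorem prepared_expectation [DecidableEq D₀] [DecidableEq D₁] [DecidableEq S]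
    {VL : Matrix (D₀ × (X₀ × X₁)) S ℂ}
    {VR : Matrix (D₁ × (Y₀ × Y₁)) Unit ℂ} (hVL : VLᴴ * VL = 1) {r : ℂ}
    (hVR : ∀ β β', ∑ y, star (VR (β, y) ()) * VR (β', y) () = if β = β' then r else 0)
    {H : Matrix (D₀ × D₁) (D₀ × D₁) ℂ} {c : ℂ}
    (hH : ∀ α α', ∑ β, r * H (α, β) (α', β) = if α = α' then c else 0) :
    (prepared VL VR)ᴴ *
      (H ⊗ₖ (1 : Matrix ((X₀ × X₁) × (Y₀ × Y₁)) ((X₀ × X₁) × (Y₀ × Y₁)) ℂ)) * prepared VL VR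
      = c • 1 := by
  ext s s'
  have h1 : ((prepared VL VR)ᴴ *
      (H ⊗ₖ (1 : Matrix ((X₀ × X₁) × (Y₀ × Y₁)) ((X₀ × X₁) × (Y₀ × Y₁)) ℂ)) * prepared VL VR) s s'
      = ∑ α, ∑ α', (∑ x, star (VL (α, x) s) * VL (α', x) s') * ∑ β, ∑ β', H (α, β) (α', β') *
        (∑ y, star (VR (β, y) ()) * VR (β', y) ()) := by
    have hP : ((prepared VL VR)ᴴ *
        (H ⊗ₖ (1 : Matrix ((X₀ × X₁) × (Y₀ × Y₁)) ((X₀ × X₁) × (Y₀ × Y₁)) ℂ)) * prepared VL VR) s s'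
        = ∑ q, ∑ q', (∑ x, star (VL (q.1, x) s) * VL (q'.1, x) s') *
          (H q q' * ∑ y, star (VR (q.2, y) ()) * VR (q'.2, y) ()) := by
      have hQ : ∀ q x y s, prepared VL VR (q, (x, y)) s = VL (q.1, x) s * VR (q.2, y) () :=
        fun _ _ _ _ => rfl
      generalize prepared VL VR = P at hQ
      simp only [Matrix.mul_apply, Matrix.conjTranspose_apply, Matrix.kroneckerMap_apply,
        Matrix.one_apply, mul_ite, mul_one, mul_zero,
        Fintype.sum_prod_type (α₁ := D₀ × D₁) (α₂ := (X₀ × X₁) × (Y₀ × Y₁)),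
        Finset.sum_ite_eq', Finset.mem_univ, if_true, Finset.sum_mul]
      simp_rw [Finset.sum_comm (s := (Finset.univ : Finset ((X₀ × X₁) × (Y₀ × Y₁))))]
      rw [Finset.sum_comm]
      refine Fintype.sum_congr _ _ fun q => Fintype.sum_congr _ _ fun q' => ?_
      rw [Fintype.sum_prod_type (α₁ := X₀ × X₁) (α₂ := Y₀ × Y₁)]
      refine Fintype.sum_congr _ _ fun x => ?_
      rw [Finset.mul_sum, Finset.mul_sum]
      refine Fintype.sum_congr _ _ fun y => ?_
      simp only [hQ, star_mul']
      ring
    rw [hP]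
    simp only [Fintype.sum_prod_type (α₁ := D₀) (α₂ := D₁), Finset.mul_sum]
    exact Fintype.sum_congr _ _ fun α => Finset.sum_comm
  have h2 : ∀ α α', ∑ β, ∑ β', H (α, β) (α', β') * (∑ y, star (VR (β, y) ()) * VR (β', y) ())
      = if α = α' then c else 0 := by
    intro α α'
    rw [← hH]
    refine Finset.sum_congr rfl fun β _ => ?_
    simp only [hVR, mul_ite, mul_zero, Finset.sum_ite_eq, Finset.mem_univ, if_true]
    ring
  have h3 := congrFun (congrFun hVL s) s'
  simp only [Matrix.mul_apply, Matrix.conjTranspose_apply,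
    Fintype.sum_prod_type (α₁ := D₀) (α₂ := X₀ × X₁)] at h3
  rw [h1, Matrix.smul_apply, ← h3, Finset.smul_sum]
  refine Finset.sum_congr rfl fun α _ => ?_
  simp only [h2]
  simp only [mul_ite, mul_zero, Finset.sum_ite_eq, Finset.mem_univ, if_true, smul_eq_mul, mul_comm c]

end Interact

/-- If the operator `T` is `O`, tensored with a unit vector `γ` of additional systems that are traced
out, then it gives the same channel. -/
theorem traceOutZ_conjBy_of_eq_mul {A₀ A₁ Z₀ Z₁ G₀ G₁ S : Type*} [Fintype Z₀] [Fintype Z₁]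
    [Fintype G₀] [Fintype G₁] [Fintype S]
    {T : Matrix ((A₀ × (Z₀ × G₀)) × (A₁ × (Z₁ × G₁))) S ℂ} {O : Matrix ((A₀ × Z₀) × (A₁ × Z₁)) S ℂ}
    {γ : G₀ → G₁ → ℂ} (hγ : ∑ g₀, ∑ g₁, γ g₀ g₁ * star (γ g₀ g₁) = 1)
    (hT : ∀ a₀ z₀ g₀ a₁ z₁ g₁ s, T ((a₀, (z₀, g₀)), (a₁, (z₁, g₁))) s
      = γ g₀ g₁ * O ((a₀, z₀), (a₁, z₁)) s) (ρ : Matrix S S ℂ) :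
    traceOutZ (conjBy T ρ) = traceOutZ (conjBy O ρ) := by
  have h : ∀ a₀ z₀ g₀ a₁ z₁ g₁ b₀ b₁,
      conjBy T ρ ((a₀, (z₀, g₀)), (a₁, (z₁, g₁))) ((b₀, (z₀, g₀)), (b₁, (z₁, g₁)))
      = (γ g₀ g₁ * star (γ g₀ g₁)) * conjBy O ρ ((a₀, z₀), (a₁, z₁)) ((b₀, z₀), (b₁, z₁)) := by
    intros
    simp only [conjBy, Matrix.mul_apply, Matrix.conjTranspose_apply, hT, Finset.mul_sum,
      Finset.sum_mul, star_mul']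
    refine Finset.sum_congr rfl fun _ _ => Finset.sum_congr rfl fun _ _ => ?_
    ring
  ext a b
  simp only [traceOutZ, Matrix.of_apply, Fintype.sum_prod_type, h]
  refine Finset.sum_congr rfl fun z₀ _ => ?_
  rw [Finset.sum_comm]
  refine Finset.sum_congr rfl fun z₁ _ => ?_
  simp only [← Finset.sum_mul]
  rw [hγ, one_mul]

/-! ### The port-based measurement -/

section PortMeasurement

variable {ι D Q₀ Q₁ : Type*} [Fintype ι] [DecidableEq ι] [Fintype D] [Fintype Q₀] [Fintype Q₁]

/-- The partial trace over the ports, divided by their dimension: the observable on `D` that has the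
same expectation as `H` when the ports are maximally mixed. -/
def portTrace (H : Matrix (D × (ι → D)) (D × (ι → D)) ℂ) : Matrix D D ℂ :=
  Matrix.of fun v v' => ∑ w, ((Fintype.card D : ℂ) ^ Fintype.card ι)⁻¹ * H (v, w) (v', w)

theorem portTrace_add (H K : Matrix (D × (ι → D)) (D × (ι → D)) ℂ) :
    portTrace (H + K) = portTrace H + portTrace K := by
  ext; simp [portTrace, mul_add, Finset.sum_add_distrib]

theorem portTrace_smul (c : ℂ) (H : Matrix (D × (ι → D)) (D × (ι → D)) ℂ) :
    portTrace (c • H) = c • portTrace H := by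
  ext; simp [portTrace, Finset.mul_sum, mul_left_comm]

theorem portTrace_sum {κ : Type*} (s : Finset κ) (H : κ → Matrix (D × (ι → D)) (D × (ι → D)) ℂ) :
    portTrace (∑ k ∈ s, H k) = ∑ k ∈ s, portTrace (H k) := by
  induction s using Finset.cons_induction with
  | empty => ext; simp [portTrace]
  | cons a s ha ih => rw [Finset.sum_cons, Finset.sum_cons, portTrace_add, ih]

variable [DecidableEq D]

/-- `d` times the projection onto the maximally entangled state of the system `D` and the port
`i`, tensored with the identity on the other ports, where `d` is the dimension of `D`. -/
def portProj (i : ι) : Matrix (D × (ι → D)) (D × (ι → D)) ℂ :=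
  Matrix.of fun p q => if p.2 i = p.1 ∧ q.2 = Function.update p.2 i q.1 then 1 else 0

/-- The ideal measurement of port-based teleportation. It projects `D` and the port `i` onto the
maximally entangled state and writes the outcome `i` into the index registers of both sides; the
components are scaled so that a state which is maximally mixed on the ports keeps its norm. It is not
an isometry. The registers `Q₀` and `Q₁` hold, after the measurement, the system `D` and the ports,
each together with an index. -/
def portMeasurement (e₀ : Q₀ ≃ D × ι) (e₁ : Q₁ ≃ (ι → D) × ι) :
    Matrix (Q₀ × Q₁) (D × (ι → D)) ℂ :=
  Matrix.of fun q p => if (e₀ q.1).2 = (e₁ q.2).2 ∧ (e₀ q.1).1 = (e₁ q.2).1 (e₀ q.1).2 ∧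
    p.2 = Function.update (e₁ q.2).1 (e₀ q.1).2 p.1
  then ((1 / √(Fintype.card ι) : ℝ) : ℂ) else 0

/-- Summing over the ports that agree with `w` outside `i` gives a factor `d`. -/
theorem sum_update_eq (i : ι) (w w' : ι → D) (v v' : D) :
    ∑ t : ι → D, (if w = Function.update t i v ∧ w' = Function.update t i v' then (1 : ℂ) else 0)
      = (Fintype.card D : ℂ) * if w i = v ∧ w' = Function.update w i v' then 1 else 0 := by
  split_ifs with h
  · obtain ⟨rfl, rfl⟩ := h
    rw [mul_one, Finset.sum_boole]
    have : Finset.univ.filter (fun t : ι → D => w = Function.update t i (w i) ∧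
        Function.update w i v' = Function.update t i v')
        = Finset.univ.image fun x => Function.update w i x := by
      ext t
      simp only [Finset.mem_filter, Finset.mem_univ, true_and, Finset.mem_image]
      constructor
      · rintro ⟨h, -⟩
        refine ⟨t i, ?_⟩
        rw [h]; simp
      · rintro ⟨x, rfl⟩
        simp
    rw [this, Finset.card_image_of_injective _ (Function.update_injective w i), Finset.card_univ]
  · rw [mul_zero]
    refine Finset.sum_eq_zero fun t _ => if_neg ?_
    rintro ⟨rfl, rfl⟩
    exact h (by simp)

theorem gram_portMeasurement (e₀ : Q₀ ≃ D × ι) (e₁ : Q₁ ≃ (ι → D) × ι) :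
    (portMeasurement e₀ e₁)ᴴ * portMeasurement e₀ e₁
      = ((Fintype.card D : ℂ) / Fintype.card ι) • ∑ i, portProj i := by
  ext ⟨v, w⟩ ⟨v', w'⟩
  have hc : (((1 / √(Fintype.card ι) : ℝ) : ℂ)) * ((1 / √(Fintype.card ι) : ℝ) : ℂ)
      = (Fintype.card ι : ℂ)⁻¹ := by
    rw [← Complex.ofReal_mul, div_mul_div_comm, Real.mul_self_sqrt (Nat.cast_nonneg _)]
    push_cast; ring
  rw [Matrix.mul_apply, Matrix.smul_apply, Matrix.sum_apply, ← (e₀.prodCongr e₁).symm.sum_comp]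
  simp only [Matrix.conjTranspose_apply, portMeasurement, portProj, Matrix.of_apply,
    Equiv.prodCongr_symm, Equiv.prodCongr_apply, Prod.map, Equiv.apply_symm_apply,
    Fintype.sum_prod_type, smul_eq_mul, Finset.mul_sum]
  rw [Finset.sum_comm]
  refine Fintype.sum_congr _ _ fun i => ?_
  have h := sum_update_eq i w w' v v'
  rw [div_mul_eq_mul_div, ← h, div_eq_mul_inv (_ : ℂ) _, ← hc, Finset.sum_mul, Finset.sum_comm]
  refine Fintype.sum_congr _ _ fun t => ?_
  rw [Finset.sum_comm]
  rw [Finset.sum_eq_single i (by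
    intro j _ hj
    refine Finset.sum_eq_zero fun x _ => ?_
    rw [if_neg (fun h => hj h.1.symm)]; simp) (by simp)]
  rw [Finset.sum_eq_single (t i) (by
    intro x _ hx
    rw [if_neg (fun h => hx h.2.1)]; simp) (by simp)]
  by_cases h1 : w = Function.update t i v <;> by_cases h2 : w' = Function.update t i v' <;>
    simp [h1, h2]

/-- Fixing the values of `w : ι → D` on `T` divides the number of choices by `d ^ #T`. -/
theorem card_pow_mul_sum_fixed_eq (T : Finset ι) (v : D) :
    (Fintype.card D : ℂ) ^ T.card *
      ∑ w : ι → D, (if ∀ k ∈ T, w k = v then (1 : ℂ) else 0)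
      = (Fintype.card D : ℂ) ^ Fintype.card ι := by
  have h1 : ∀ w : ι → D, (if ∀ k ∈ T, w k = v then (1 : ℂ) else 0)
      = ∏ k, if k ∈ T → w k = v then (1 : ℂ) else 0 := by
    intro w
    rw [Fintype.prod_boole]
  have h2 : ∀ k, ∑ x : D, (if k ∈ T → x = v then (1 : ℂ) else 0)
      = if k ∈ T then 1 else (Fintype.card D : ℂ) := by
    intro k
    by_cases hk : k ∈ T <;> simp [hk]
  have h3 : (Fintype.card D : ℂ) ^ T.card = ∏ k, if k ∈ T then (Fintype.card D : ℂ) else 1 := by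
    rw [Finset.prod_ite_mem, Finset.univ_inter, Finset.prod_const]
  simp_rw [h1]
  rw [← Fintype.prod_sum (fun k (x : D) => if k ∈ T → x = v then (1 : ℂ) else 0), h3,
    ← Finset.prod_mul_distrib, ← Finset.card_univ (α := ι), ← Finset.prod_const]
  refine Finset.prod_congr rfl fun k _ => ?_
  rw [h2]
  split_ifs <;> simp

theorem portProj_mul_self (i : ι) :
    portProj (D := D) i * portProj i = (Fintype.card D : ℂ) • portProj i := by
  ext ⟨v, w⟩ ⟨v', w'⟩
  rw [Matrix.mul_apply, Matrix.smul_apply, Fintype.sum_prod_type]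
  simp only [portProj, Matrix.of_apply]
  have h : ∀ x : D, ∑ u : ι → D, ((if w i = v ∧ u = Function.update w i x then (1 : ℂ) else 0) *
      if u i = x ∧ w' = Function.update u i v' then 1 else 0)
      = if w i = v ∧ w' = Function.update w i v' then 1 else 0 := by
    intro x
    rw [Finset.sum_eq_single (Function.update w i x) (by
      intro u _ hu
      rw [if_neg (fun h => hu h.2), zero_mul]) (by simp)]
    by_cases h1 : w i = v <;> simp [h1]
  rw [Finset.sum_congr rfl fun x _ => h x]
  simp

/-- The diagonal, with respect to the ports, of the product of two different projections. -/
theorem portProj_mul_of_ne {i j : ι} (hij : i ≠ j) (v v' : D) (w : ι → D) :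
    (portProj i * portProj j : Matrix (D × (ι → D)) (D × (ι → D)) ℂ) (v, w) (v', w)
      = if v = v' then (if ∀ k ∈ ({i, j} : Finset ι), w k = v then 1 else 0) else 0 := by
  rw [Matrix.mul_apply, Fintype.sum_prod_type]
  simp only [portProj, Matrix.of_apply]
  have h : ∀ x : D, ∑ u : ι → D, ((if w i = v ∧ u = Function.update w i x then (1 : ℂ) else 0) *
      if u j = x ∧ w = Function.update u j v' then 1 else 0)
      = if x = w j then (if w i = v ∧ w i = x ∧ w j = v' then 1 else 0) else 0 := by
    intro x
    rw [Finset.sum_eq_single (Function.update w i x) (by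
      intro u _ hu
      rw [if_neg (fun h => hu h.2), zero_mul]) (by simp)]
    have h1 : w = Function.update (Function.update w i x) j v' ↔ w i = x ∧ w j = v' := by
      constructor
      · intro h
        refine ⟨?_, ?_⟩
        · have := congrFun h i
          rwa [Function.update_of_ne hij, Function.update_self] at this
        · have := congrFun h j
          rwa [Function.update_self] at this
      · rintro ⟨rfl, rfl⟩
        simp
    simp only [h1, Function.update_of_ne hij.symm, @eq_comm _ x (w j)]
    by_cases h2 : w i = v <;> by_cases h3 : w j = x <;> simp [h2, h3]
  simp only [h, Finset.sum_ite_eq', Finset.mem_univ, if_true, Finset.mem_insert,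
    Finset.mem_singleton, forall_eq_or_imp, forall_eq]
  by_cases hv : v = v'
  · subst hv
    rw [if_pos rfl]
    congr 1
    rw [eq_iff_iff]
    constructor
    · rintro ⟨h1, -, h3⟩; exact ⟨h1, h3⟩
    · rintro ⟨h1, h2⟩; exact ⟨h1, h1.trans h2.symm, h2⟩
  · rw [if_neg hv, if_neg]
    rintro ⟨h1, h2, h3⟩
    exact hv (h1.symm.trans (h2.trans h3))

theorem portTrace_of_fixed [Nonempty D] {T : Finset ι} {H : Matrix (D × (ι → D)) (D × (ι → D)) ℂ}
    (hH : ∀ v v' w, H (v, w) (v', w)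
      = if v = v' then (if ∀ k ∈ T, w k = v then 1 else 0) else 0) :
    portTrace H = ((Fintype.card D : ℂ) ^ T.card)⁻¹ • 1 := by
  have hd : (Fintype.card D : ℂ) ≠ 0 := Nat.cast_ne_zero.2 Fintype.card_ne_zero
  ext v v'
  simp only [portTrace, Matrix.of_apply, hH, Matrix.smul_apply, Matrix.one_apply, smul_eq_mul]
  split_ifs with h
  · rw [← Finset.mul_sum, ← card_pow_mul_sum_fixed_eq T v, mul_one, mul_inv, mul_assoc, inv_mul_cancel₀,
      mul_one]
    intro h0
    have := card_pow_mul_sum_fixed_eq T v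
    rw [h0, mul_zero] at this
    exact pow_ne_zero _ hd this.symm
  · simp

theorem portTrace_one [Nonempty D] : portTrace (1 : Matrix (D × (ι → D)) (D × (ι → D)) ℂ) = 1 := by
  rw [portTrace_of_fixed (T := ∅)]
  · simp
  · intro v v' w
    simp [Matrix.one_apply]

theorem portTrace_portProj [Nonempty D] (i : ι) :
    portTrace (portProj (D := D) i) = (Fintype.card D : ℂ)⁻¹ • 1 := by
  rw [portTrace_of_fixed (T := {i})]
  · simp
  · intro v v' w
    simp only [portProj, Matrix.of_apply, Finset.mem_singleton, forall_eq]
    simp only [Function.eq_update_self_iff]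
    by_cases h : v = v'
    · subst h; simp
    · rw [if_neg h, if_neg]
      rintro ⟨h1, h2⟩
      exact h (h1.symm.trans h2)

theorem portTrace_gram [Nonempty D] [Nonempty ι] :
    portTrace (((Fintype.card D : ℂ) / Fintype.card ι) • ∑ i : ι, portProj (D := D) i) = 1 := by
  have hd : (Fintype.card D : ℂ) ≠ 0 := Nat.cast_ne_zero.2 Fintype.card_ne_zero
  have hn : (Fintype.card ι : ℂ) ≠ 0 := Nat.cast_ne_zero.2 Fintype.card_ne_zero
  rw [portTrace_smul, portTrace_sum]
  simp only [portTrace_portProj, Finset.sum_const, Finset.card_univ]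
  rw [← Nat.cast_smul_eq_nsmul ℂ, smul_smul, smul_smul]
  rw [show (Fintype.card D : ℂ) / Fintype.card ι * Fintype.card ι * (Fintype.card D : ℂ)⁻¹ = 1 by
    field_simp, one_smul]

/-- The mean square deviation of the ideal measurement from an isometry: it tends to zero with the
number of ports because the projections for two different ports are uncorrelated. -/
theorem portTrace_one_sub_gram_sq [Nonempty D] [Nonempty ι] :
    portTrace ((1 - ((Fintype.card D : ℂ) / Fintype.card ι) • ∑ i : ι, portProj (D := D) i) *
      (1 - ((Fintype.card D : ℂ) / Fintype.card ι) • ∑ i : ι, portProj (D := D) i))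
      = (((Fintype.card D : ℂ) ^ 2 - 1) / Fintype.card ι) • 1 := by
  have hd : (Fintype.card D : ℂ) ≠ 0 := Nat.cast_ne_zero.2 Fintype.card_ne_zero
  have hn : (Fintype.card ι : ℂ) ≠ 0 := Nat.cast_ne_zero.2 Fintype.card_ne_zero
  have hFF : ∀ i j : ι, portTrace (portProj (D := D) i * portProj j)
      = (if i = j then (1 - ((Fintype.card D : ℂ) ^ 2)⁻¹) else 0) • 1
        + ((Fintype.card D : ℂ) ^ 2)⁻¹ • 1 := by
    intro i j
    split_ifs with h
    · subst h
      rw [portProj_mul_self, portTrace_smul, portTrace_portProj, smul_smul, mul_inv_cancel₀ hd,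
        ← add_smul, sub_add_cancel]
    · rw [portTrace_of_fixed (portProj_mul_of_ne h), Finset.card_pair h, zero_smul, zero_add]
  set g : ℂ := (Fintype.card D : ℂ) / Fintype.card ι with hg
  have hexp : (1 - g • ∑ i : ι, portProj (D := D) i) * (1 - g • ∑ i : ι, portProj (D := D) i)
      = 1 + (-2 : ℂ) • (g • ∑ i : ι, portProj (D := D) i)
        + (g * g) • ∑ i : ι, ∑ j : ι, portProj (D := D) i * portProj j := by
    have : ∑ i : ι, ∑ j : ι, portProj (D := D) i * portProj j
        = (∑ i : ι, portProj (D := D) i) * ∑ i : ι, portProj (D := D) i := by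
      rw [Finset.sum_mul_sum]
    rw [this, sub_mul, mul_sub, mul_sub, Matrix.one_mul, Matrix.mul_one, Matrix.one_mul,
      Matrix.smul_mul, Matrix.mul_smul, smul_smul, neg_smul, two_smul]
    abel
  rw [hexp, portTrace_add, portTrace_add, portTrace_one, portTrace_smul, portTrace_gram,
    portTrace_smul, portTrace_sum]
  simp only [portTrace_sum, hFF, Finset.sum_add_distrib, ← Finset.sum_smul, Finset.sum_ite_eq,
    Finset.mem_univ, if_true, Finset.sum_const, Finset.card_univ, nsmul_eq_mul]
  rw [← add_smul, smul_smul]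
  nth_rw 1 [← one_smul ℂ (1 : Matrix D D ℂ)]
  rw [← add_smul, ← add_smul]
  congr 1
  rw [hg]
  field_simp
  ring

end PortMeasurement

/-! ### Processing the selected port -/

section SelectPort

variable {n : ℕ} {A Z D Q X Y : Type*}

/-- Given a register `Q` that holds a system `D` and the index of a port, separate the message in
this port from those in the other ports. -/
def portEquiv (X Y : Type*) (e : Q ≃ D × Fin (n + 1)) :
    Q × (X × (Fin (n + 1) → Y)) ≃ (X × Y) × (D × (Fin (n + 1) × (Fin n → Y))) where
  toFun p := ((p.2.1, p.2.2 (e p.1).2), ((e p.1).1, ((e p.1).2, (e p.1).2.removeNth p.2.2)))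
  invFun g := (e.symm (g.2.1, g.2.2.1), (g.1.1, g.2.2.1.insertNth g.1.2 g.2.2.2))
  left_inv p := by simp
  right_inv g := by simp

variable [Fintype Y] [Fintype D] [DecidableEq Y] [DecidableEq D]

/-- Apply the isometry `W` to the message in the port whose index is held by the register `Q`. -/
def selectPort (W : Matrix (A × Z) (X × Y) ℂ) (e : Q ≃ D × Fin (n + 1)) :
    Matrix (A × (Z × (D × (Fin (n + 1) × (Fin n → Y))))) (Q × (X × (Fin (n + 1) → Y))) ℂ :=
  (W ⊗ₖ (1 : Matrix (D × (Fin (n + 1) × (Fin n → Y))) (D × (Fin (n + 1) × (Fin n → Y))) ℂ)).submatrix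
    (fun r => ((r.1, r.2.1), r.2.2)) (portEquiv X Y e)

theorem selectPort_isometry [Fintype A] [Fintype Z] [DecidableEq X] [DecidableEq Q]
    {W : Matrix (A × Z) (X × Y) ℂ}
    (hW : Wᴴ * W = 1) (e : Q ≃ D × Fin (n + 1)) : (selectPort W e)ᴴ * selectPort W e = 1 := by
  have h : selectPort W e = (W ⊗ₖ (1 : Matrix (D × (Fin (n + 1) × (Fin n → Y)))
    (D × (Fin (n + 1) × (Fin n → Y))) ℂ)).submatrix (Equiv.prodAssoc _ _ _).symm
      (portEquiv X Y e) := rfl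
  rw [h, Matrix.conjTranspose_submatrix, Matrix.submatrix_mul_equiv, Matrix.conjTranspose_kronecker,
    ← Matrix.mul_kronecker_mul, hW, Matrix.conjTranspose_one, Matrix.mul_one,
    Matrix.one_kronecker_one, Matrix.submatrix_one_equiv]

theorem sum_selectPort [Fintype X] [Fintype Q] (W : Matrix (A × Z) (X × Y) ℂ)
    (e : Q ≃ D × Fin (n + 1)) (a : A) (z : Z)
    (g : D × (Fin (n + 1) × (Fin n → Y))) (f : Q × (X × (Fin (n + 1) → Y)) → ℂ) :
    ∑ c, selectPort W e (a, (z, g)) c * f c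
      = ∑ m, W (a, z) m * f ((portEquiv X Y e).symm (m, g)) := by
  rw [← (portEquiv X Y e).symm.sum_comp, Fintype.sum_prod_type (α₁ := X × Y)]
  refine Fintype.sum_congr _ _ fun m => ?_
  simp [selectPort, Matrix.one_apply]

end SelectPort

/-! ### The ideal port-based protocol -/

section PortProtocol

variable {n : ℕ} {A₀ A₁ Z₀ Z₁ X₀ X₁ Y₀ Y₁ Q₀ Q₁ D S : Type*}
  [Fintype X₀] [Fintype X₁] [Fintype Y₀] [Fintype Y₁] [Fintype Q₀] [Fintype Q₁]
  [DecidableEq D]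

/-- The left applies `V` to its input and to one half of a maximally entangled state of `D ⊗ D`
(with amplitudes `κ`), and keeps the other half. -/
def leftState (κ : ℝ) (V : Matrix (X₀ × X₁) (S × D) ℂ) : Matrix (D × (X₀ × X₁)) S ℂ :=
  Matrix.of fun p s => κ * V p.2 (s, p.1)

/-- The right prepares `n + 1` maximally entangled states of `D ⊗ D`, applies `R` to one half of
each of them, and keeps the other halves as ports. -/
def rightState (n : ℕ) (κ : ℝ) (R : Matrix (Y₀ × Y₁) D ℂ) :
    Matrix ((Fin (n + 1) → D) × ((Fin (n + 1) → Y₀) × (Fin (n + 1) → Y₁))) Unit ℂ :=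
  Matrix.of fun p _ => ∏ j, (κ * R (p.2.1 j, p.2.2 j) (p.1 j))

/-- The reduced state of the ports is maximally mixed. -/
theorem rightState_gram {κ : ℝ} {R : Matrix (Y₀ × Y₁) D ℂ} (hR : Rᴴ * R = 1)
    (w w' : Fin (n + 1) → D) :
    ∑ y, star (rightState n κ R (w, y) ()) * rightState n κ R (w', y) ()
      = if w = w' then (κ : ℂ) ^ (2 * (n + 1)) else 0 := by
  have h : ∀ v v' : D, ∑ y : Y₀ × Y₁, star ((κ : ℂ) * R y v) * (κ * R y v')
      = if v = v' then (κ : ℂ) ^ 2 else 0 := by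
    intro v v'
    have h1 := congrFun (congrFun hR v) v'
    simp only [Matrix.mul_apply, Matrix.conjTranspose_apply, Matrix.one_apply] at h1
    rw [← mul_boole, ← h1, Finset.mul_sum]
    refine Fintype.sum_congr _ _ fun x => ?_
    simp only [star_mul', RCLike.star_def, Complex.conj_ofReal]
    ring
  rw [← (Equiv.arrowProdEquivProdArrow (Fin (n + 1)) (fun _ => Y₀) (fun _ => Y₁)).sum_comp]
  have h2 : ∀ y : Fin (n + 1) → Y₀ × Y₁,
      star (rightState n κ R (w, Equiv.arrowProdEquivProdArrow _ _ _ y) ())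
        * rightState n κ R (w', Equiv.arrowProdEquivProdArrow _ _ _ y) ()
      = ∏ j, star ((κ : ℂ) * R (y j) (w j)) * (κ * R (y j) (w' j)) := by
    intro y
    rw [Finset.prod_mul_distrib, ← star_prod]
    rfl
  simp only [h2]
  rw [← Fintype.prod_sum (fun j (y : Y₀ × Y₁) => star ((κ : ℂ) * R y (w j)) * (κ * R y (w' j)))]
  simp only [h]
  split_ifs with hw
  · subst hw
    simp [pow_mul]
  · obtain ⟨j, hj⟩ := Function.ne_iff.1 hw
    exact Finset.prod_eq_zero (Finset.mem_univ j) (if_neg hj)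

variable [Fintype D]

theorem leftState_isometry [DecidableEq S] {κ : ℝ} (hκ : κ ^ 2 * Fintype.card D = 1)
    {V : Matrix (X₀ × X₁) (S × D) ℂ} (hV : Vᴴ * V = 1) :
    (leftState κ V)ᴴ * leftState κ V = 1 := by
  ext s s'
  have h : ∀ v : D, ∑ x, star (V x (s, v)) * V x (s', v) = if s = s' then 1 else 0 := by
    intro v
    have := congrFun (congrFun hV (s, v)) (s', v)
    simpa only [Matrix.mul_apply, Matrix.conjTranspose_apply, Matrix.one_apply, Prod.mk.injEq,
      and_true] using this
  have hκ' : (κ : ℂ) * κ * Fintype.card D = 1 := by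
    rw [← sq]; exact_mod_cast hκ
  rw [Matrix.mul_apply, Fintype.sum_prod_type (α₁ := D), Matrix.one_apply]
  calc ∑ v : D, ∑ x, (leftState κ V)ᴴ s (v, x) * leftState κ V (v, x) s'
      = ∑ v : D, (κ : ℂ) * κ * ∑ x, star (V x (s, v)) * V x (s', v) := by
        refine Fintype.sum_congr _ _ fun v => ?_
        rw [Finset.mul_sum]
        refine Fintype.sum_congr _ _ fun x => ?_
        simp only [Matrix.conjTranspose_apply, leftState, Matrix.of_apply, star_mul',
          RCLike.star_def, Complex.conj_ofReal]
        ring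
    _ = _ := by
        simp only [h, Finset.sum_const, Finset.card_univ, nsmul_eq_mul]
        rw [← mul_assoc, mul_comm (Fintype.card D : ℂ), hκ', one_mul]

/-- The amplitudes of the systems that are discarded after the ideal port-based measurement: the
index of the selected port, held by both sides, the maximally entangled state onto which that port has
been projected, and the other ports with their messages. -/
def residue (κ : ℝ) (R : Matrix (Y₀ × Y₁) D ℂ) (g₀ : D × (Fin (n + 1) × (Fin n → Y₀)))
    (g₁ : (Fin (n + 1) → D) × (Fin (n + 1) × (Fin n → Y₁))) : ℂ :=
  if g₀.2.1 = g₁.2.1 ∧ g₀.1 = g₁.1 g₀.2.1 then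
    ((1 / √(Fintype.card (Fin (n + 1))) : ℝ) : ℂ) * (κ *
      ∏ j, (κ * R (g₀.2.2 j, g₁.2.2 j) (g₁.1 (g₀.2.1.succAbove j)))) else 0

theorem residue_norm {κ : ℝ} (hκ : κ ^ 2 * Fintype.card D = 1) {R : Matrix (Y₀ × Y₁) D ℂ}
    (hR : Rᴴ * R = 1) :
    ∑ g₀, ∑ g₁, residue (n := n) κ R g₀ g₁ * star (residue κ R g₀ g₁) = 1 := by
  have hκ' : (κ : ℂ) * κ * Fintype.card D = 1 := by
    rw [← sq]; exact_mod_cast hκ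
  set N : ℕ := Fintype.card (Fin (n + 1)) with hN
  have hc : ((1 / √N : ℝ) : ℂ) * star ((1 / √N : ℝ) : ℂ) = (N : ℂ)⁻¹ := by
    rw [RCLike.star_def, Complex.conj_ofReal, ← Complex.ofReal_mul, div_mul_div_comm,
      Real.mul_self_sqrt (Nat.cast_nonneg _)]
    push_cast; ring
  have hrow : ∀ v : D, ∑ y : Y₀ × Y₁, ((κ : ℂ) * R y v) * star ((κ : ℂ) * R y v) = (κ : ℂ) * κ := by
    intro v
    have h1 := congrFun (congrFun hR v) v
    simp only [Matrix.mul_apply, Matrix.conjTranspose_apply, Matrix.one_apply, if_true] at h1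
    rw [← mul_one ((κ : ℂ) * κ), ← h1, Finset.mul_sum]
    refine Fintype.sum_congr _ _ fun x => ?_
    simp only [star_mul', RCLike.star_def, Complex.conj_ofReal]
    ring
  have hprod : ∀ u : Fin n → D, ∑ r₀ : Fin n → Y₀, ∑ r₁ : Fin n → Y₁,
      (∏ j, ((κ : ℂ) * R (r₀ j, r₁ j) (u j))) * star (∏ j, ((κ : ℂ) * R (r₀ j, r₁ j) (u j)))
      = ((κ : ℂ) * κ) ^ n := by
    intro u
    have h := Fintype.prod_sum (fun (j : Fin n) (y : Y₀ × Y₁) =>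
      ((κ : ℂ) * R y (u j)) * star ((κ : ℂ) * R y (u j)))
    simp only [hrow, Finset.prod_const, Finset.card_univ, Fintype.card_fin] at h
    rw [h, ← (Equiv.arrowProdEquivProdArrow (Fin n) (fun _ => Y₀) (fun _ => Y₁)).symm.sum_comp,
      Fintype.sum_prod_type (α₁ := Fin n → Y₀)]
    refine Fintype.sum_congr _ _ fun r₀ => Fintype.sum_congr _ _ fun r₁ => ?_
    rw [star_prod, ← Finset.prod_mul_distrib]
    rfl
  have hsq : ∀ v i r₀ w i' r₁, residue (n := n) κ R (v, (i, r₀)) (w, (i', r₁))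
      * star (residue κ R (v, (i, r₀)) (w, (i', r₁)))
      = if i' = i then (if v = w i then (N : ℂ)⁻¹ * (κ * κ) *
          ((∏ j, ((κ : ℂ) * R (r₀ j, r₁ j) (w (i.succAbove j)))) *
          star (∏ j, ((κ : ℂ) * R (r₀ j, r₁ j) (w (i.succAbove j))))) else 0) else 0 := by
    intro v i r₀ w i' r₁
    by_cases h1 : i = i'
    · subst h1
      by_cases h2 : v = w i
      · simp only [residue, h2, and_self, if_true, ← hc, star_mul']
        rw [show star (κ : ℂ) = κ from Complex.conj_ofReal κ]
        ring
      · simp [residue, h2]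
    · simp [residue, h1, Ne.symm h1]
  simp only [Fintype.sum_prod_type (α₂ := Fin (n + 1) × _), Fintype.sum_prod_type (α₁ := Fin (n + 1)),
    hsq]
  have hi' : ∀ (v : D) (i : Fin (n + 1)) (r₀ : Fin n → Y₀) (w : Fin (n + 1) → D),
      ∑ i', ∑ r₁ : Fin n → Y₁, (if i' = i then (if v = w i then (N : ℂ)⁻¹ * (κ * κ) *
          ((∏ j, ((κ : ℂ) * R (r₀ j, r₁ j) (w (i.succAbove j)))) *
          star (∏ j, ((κ : ℂ) * R (r₀ j, r₁ j) (w (i.succAbove j))))) else 0) else 0)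
      = if v = w i then ∑ r₁ : Fin n → Y₁, (N : ℂ)⁻¹ * (κ * κ) *
          ((∏ j, ((κ : ℂ) * R (r₀ j, r₁ j) (w (i.succAbove j)))) *
          star (∏ j, ((κ : ℂ) * R (r₀ j, r₁ j) (w (i.succAbove j))))) else 0 := by
    intro v i r₀ w
    rw [Finset.sum_eq_single i (fun i' _ h => by simp [h]) (by simp)]
    by_cases h : v = w i <;> simp [h]
  simp only [hi']
  rw [Finset.sum_comm]
  have hi : ∀ i : Fin (n + 1), ∑ v : D, ∑ r₀ : Fin n → Y₀, ∑ w : Fin (n + 1) → D,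
      (if v = w i then ∑ r₁ : Fin n → Y₁, (N : ℂ)⁻¹ * (κ * κ) *
          ((∏ j, ((κ : ℂ) * R (r₀ j, r₁ j) (w (i.succAbove j)))) *
          star (∏ j, ((κ : ℂ) * R (r₀ j, r₁ j) (w (i.succAbove j))))) else 0) = (N : ℂ)⁻¹ := by
    intro i
    simp_rw [Finset.sum_comm (s := (Finset.univ : Finset (Fin n → Y₀)))]
    rw [Finset.sum_comm]
    have hw : ∀ w : Fin (n + 1) → D, ∑ v : D, ∑ r₀ : Fin n → Y₀,
        (if v = w i then ∑ r₁ : Fin n → Y₁, (N : ℂ)⁻¹ * (κ * κ) *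
          ((∏ j, ((κ : ℂ) * R (r₀ j, r₁ j) (w (i.succAbove j)))) *
          star (∏ j, ((κ : ℂ) * R (r₀ j, r₁ j) (w (i.succAbove j))))) else 0)
        = (N : ℂ)⁻¹ * (κ * κ) ^ (n + 1) := by
      intro w
      rw [Finset.sum_eq_single (w i) (fun v _ h => by simp [h]) (by simp)]
      simp only [if_true, ← Finset.mul_sum]
      rw [hprod (fun j => w (i.succAbove j)), pow_succ]
      ring
    simp only [hw, Finset.sum_const, Finset.card_univ, Fintype.card_fun, Fintype.card_fin,
      nsmul_eq_mul]
    push_cast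
    rw [mul_left_comm, ← mul_pow, mul_comm (Fintype.card D : ℂ), hκ', one_pow, mul_one]
  simp only [hi, Finset.sum_const, Finset.card_univ, nsmul_eq_mul]
  rw [← hN, mul_inv_cancel₀]
  rw [hN, Fintype.card_fin]
  exact Nat.cast_ne_zero.2 (Nat.succ_ne_zero n)

variable [DecidableEq X₀] [DecidableEq X₁] [DecidableEq Y₀] [DecidableEq Y₁]

/-- With the ideal measurement as interaction, the port selected on both sides carries the message of
the non-local protocol, and the discarded systems are in a state that does not depend on the input. -/
theorem interact_selectPort_portMeasurement (WL : Matrix (A₀ × Z₀) (X₀ × Y₀) ℂ)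
    (WR : Matrix (A₁ × Z₁) (X₁ × Y₁) ℂ) (κ : ℝ) (V : Matrix (X₀ × X₁) (S × D) ℂ)
    (R : Matrix (Y₀ × Y₁) D ℂ) (e₀ : Q₀ ≃ D × Fin (n + 1))
    (e₁ : Q₁ ≃ (Fin (n + 1) → D) × Fin (n + 1)) (a₀ : A₀) (z₀ : Z₀)
    (g₀ : D × (Fin (n + 1) × (Fin n → Y₀))) (a₁ : A₁) (z₁ : Z₁)
    (g₁ : (Fin (n + 1) → D) × (Fin (n + 1) × (Fin n → Y₁))) (s : S) :
    interact (selectPort WL e₀) (selectPort WR e₁) (leftState κ V) (rightState n κ R)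
      (portMeasurement e₀ e₁) ((a₀, (z₀, g₀)), (a₁, (z₁, g₁))) s
    = residue κ R g₀ g₁ * ∑ m₀, ∑ m₁, WL (a₀, z₀) m₀ * WR (a₁, z₁) m₁ *
        ∑ u, κ * V (m₀.1, m₁.1) (s, u) * R (m₀.2, m₁.2) u := by
  have hF : ∀ m₀ m₁, (((portMeasurement e₀ e₁) ⊗ₖ (1 : Matrix ((X₀ × X₁) ×
      ((Fin (n + 1) → Y₀) × (Fin (n + 1) → Y₁))) ((X₀ × X₁) ×
      ((Fin (n + 1) → Y₀) × (Fin (n + 1) → Y₁))) ℂ)) *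
      prepared (leftState κ V) (rightState n κ R))
      ((((portEquiv X₀ Y₀ e₀).symm (m₀, g₀)).1, ((portEquiv X₁ Y₁ e₁).symm (m₁, g₁)).1),
        ((((portEquiv X₀ Y₀ e₀).symm (m₀, g₀)).2.1, ((portEquiv X₁ Y₁ e₁).symm (m₁, g₁)).2.1),
        (((portEquiv X₀ Y₀ e₀).symm (m₀, g₀)).2.2, ((portEquiv X₁ Y₁ e₁).symm (m₁, g₁)).2.2))) s
      = residue κ R g₀ g₁ * ∑ u, κ * V (m₀.1, m₁.1) (s, u) * R (m₀.2, m₁.2) u := by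
    intro m₀ m₁
    obtain ⟨v, i, r₀⟩ := g₀
    obtain ⟨w, i', r₁⟩ := g₁
    have hP : ∀ q x y, prepared (leftState κ V) (rightState n κ R) (q, (x, y)) s
        = κ * V x (s, q.1) * ∏ j, (κ * R (y.1 j, y.2 j) (q.2 j)) := fun _ _ _ => rfl
    generalize prepared (leftState κ V) (rightState n κ R) = P at hP
    simp only [Matrix.mul_apply, Matrix.kroneckerMap_apply, Matrix.one_apply, mul_ite, mul_one,
      mul_zero, ite_mul, zero_mul, Fintype.sum_prod_type (α₁ := D × (Fin (n + 1) → D)),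
      Finset.sum_ite_eq, Finset.mem_univ, if_true, hP]
    simp only [Fintype.sum_prod_type (α₁ := D), portMeasurement, Matrix.of_apply, portEquiv,
      Equiv.coe_fn_symm_mk, Equiv.apply_symm_apply, residue]
    by_cases hc : i = i' ∧ v = w i
    · obtain ⟨rfl, rfl⟩ := hc
      simp only [true_and, ite_mul, zero_mul, Finset.sum_ite_eq', Finset.mem_univ, if_true, and_self]
      rw [Finset.mul_sum]
      refine Fintype.sum_congr _ _ fun u => ?_
      rw [Fin.prod_univ_succAbove _ i]
      simp only [Fin.insertNth_apply_same, Fin.insertNth_apply_succAbove, Function.update_self,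
        Function.update_of_ne (Fin.succAbove_ne i _)]
      ring
    · rw [if_neg hc, zero_mul]
      refine Finset.sum_eq_zero fun u _ => Finset.sum_eq_zero fun t _ => ?_
      rw [if_neg (fun h => hc ⟨h.1, h.2.1⟩), zero_mul]
  have h1 : interact (selectPort WL e₀) (selectPort WR e₁) (leftState κ V) (rightState n κ R)
      (portMeasurement e₀ e₁) ((a₀, (z₀, g₀)), (a₁, (z₁, g₁))) s
      = ∑ c₀, selectPort WL e₀ (a₀, (z₀, g₀)) c₀ * ∑ c₁, selectPort WR e₁ (a₁, (z₁, g₁)) c₁ *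
        (((portMeasurement e₀ e₁) ⊗ₖ (1 : Matrix ((X₀ × X₁) ×
          ((Fin (n + 1) → Y₀) × (Fin (n + 1) → Y₁))) ((X₀ × X₁) ×
          ((Fin (n + 1) → Y₀) × (Fin (n + 1) → Y₁))) ℂ)) *
          prepared (leftState κ V) (rightState n κ R))
          ((c₀.1, c₁.1), ((c₀.2.1, c₁.2.1), (c₀.2.2, c₁.2.2))) s := by
    rw [interact, Matrix.mul_apply,
      Fintype.sum_prod_type (α₁ := Q₀ × (X₀ × (Fin (n + 1) → Y₀)))]
    refine Fintype.sum_congr _ _ fun c₀ => ?_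
    rw [Finset.mul_sum]
    refine Fintype.sum_congr _ _ fun c₁ => ?_
    rw [Matrix.kroneckerMap_apply, Matrix.submatrix_apply, mul_assoc]
    rfl
  rw [h1, sum_selectPort WL e₀ a₀ z₀ g₀ (fun c₀ => ∑ c₁, selectPort WR e₁ (a₁, (z₁, g₁)) c₁ * _),
    Finset.mul_sum]
  refine Fintype.sum_congr _ _ fun m₀ => ?_
  rw [sum_selectPort WR e₁ a₁ z₁ g₁ (fun c₁ => _), Finset.mul_sum, Finset.mul_sum]
  refine Fintype.sum_congr _ _ fun m₁ => ?_
  rw [hF]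
  ring

end PortProtocol

/-! ### Replacing the ideal measurement by a unitary -/

section NormBounds

open scoped Matrix.Norms.L2Operator MatrixOrder ComplexOrder

/-- The version of `Matrix.exists_unitary_near` for an operator `M` on a subspace, embedded by an
isometry `J`. -/
theorem Matrix.exists_unitary_mul_isometry_near {m n : Type*} [Fintype m] [DecidableEq m]
    [Fintype n] [DecidableEq n] {J : Matrix m n ℂ} (hJ : Jᴴ * J = 1) (M : Matrix m n ℂ) :
    ∃ U ∈ Matrix.unitaryGroup m ℂ,
      ((1 - Mᴴ * M) * (1 - Mᴴ * M) - (U * J - M)ᴴ * (U * J - M)).PosSemidef := by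
  obtain ⟨U, hU, h⟩ := Matrix.exists_unitary_near (M * Jᴴ)
  refine ⟨U, hU, ?_⟩
  have h1 := h.conjTranspose_mul_mul_same J
  have hB : U * J - M = (U - M * Jᴴ) * J := by
    rw [Matrix.sub_mul, Matrix.mul_assoc, hJ, Matrix.mul_one]
  have hG : (M * Jᴴ)ᴴ * (M * Jᴴ) = J * (Mᴴ * M) * Jᴴ := by
    rw [Matrix.conjTranspose_mul, Matrix.conjTranspose_conjTranspose]
    simp only [Matrix.mul_assoc]
  have hr : (1 - J * (Mᴴ * M) * Jᴴ) * J = J * (1 - Mᴴ * M) := by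
    rw [Matrix.sub_mul, Matrix.mul_sub, Matrix.mul_assoc _ Jᴴ J, hJ]
    simp
  have hl : Jᴴ * (1 - J * (Mᴴ * M) * Jᴴ) = (1 - Mᴴ * M) * Jᴴ := by
    rw [Matrix.mul_sub, Matrix.sub_mul, ← Matrix.mul_assoc, ← Matrix.mul_assoc Jᴴ J, hJ]
    simp
  rw [Matrix.mul_sub Jᴴ, Matrix.sub_mul (Jᴴ * _) (Jᴴ * _) J, hG] at h1
  have hL : (1 - Mᴴ * M) * (1 - Mᴴ * M)
      = Jᴴ * ((1 - J * (Mᴴ * M) * Jᴴ) * (1 - J * (Mᴴ * M) * Jᴴ)) * J := by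
    calc (1 - Mᴴ * M) * (1 - Mᴴ * M) = (1 - Mᴴ * M) * (Jᴴ * J) * (1 - Mᴴ * M) := by
          rw [hJ, Matrix.mul_one]
      _ = ((1 - Mᴴ * M) * Jᴴ) * (J * (1 - Mᴴ * M)) := by simp only [Matrix.mul_assoc]
      _ = _ := by rw [← hl, ← hr]; simp only [Matrix.mul_assoc]
  rw [hL, hB, Matrix.conjTranspose_mul]
  simpa only [Matrix.mul_assoc] using h1

variable {n : ℕ} {A₀ A₁ Z₀ Z₁ X₀ X₁ Y₀ Y₁ Q₀ Q₁ D S : Type*}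
  [Fintype A₀] [Fintype A₁] [Fintype Z₀] [Fintype Z₁]
  [Fintype X₀] [Fintype X₁] [Fintype Y₀] [Fintype Y₁] [Fintype Q₀] [Fintype Q₁] [Fintype D]
  [DecidableEq X₀] [DecidableEq X₁] [DecidableEq Y₀] [DecidableEq Y₁] [DecidableEq Q₀]
  [DecidableEq Q₁] [DecidableEq D] [DecidableEq S]

theorem port_expectation {κ : ℝ} (hκ : κ ^ 2 * Fintype.card D = 1)
    {V : Matrix (X₀ × X₁) (S × D) ℂ} (hV : Vᴴ * V = 1) {R : Matrix (Y₀ × Y₁) D ℂ}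
    (hR : Rᴴ * R = 1) {H : Matrix (D × (Fin (n + 1) → D)) (D × (Fin (n + 1) → D)) ℂ} {c : ℂ}
    (hH : portTrace H = c • 1) :
    (prepared (leftState κ V) (rightState n κ R))ᴴ * (H ⊗ₖ (1 : Matrix ((X₀ × X₁) ×
      ((Fin (n + 1) → Y₀) × (Fin (n + 1) → Y₁))) ((X₀ × X₁) ×
      ((Fin (n + 1) → Y₀) × (Fin (n + 1) → Y₁))) ℂ)) *
      prepared (leftState κ V) (rightState n κ R) = c • 1 := by
  have hκ' : (κ : ℂ) ^ 2 * Fintype.card D = 1 := by exact_mod_cast hκ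
  refine prepared_expectation (leftState_isometry hκ hV) (rightState_gram hR) fun v v' => ?_
  have h := congrFun (congrFun hH v) v'
  simp only [portTrace, Matrix.of_apply, Matrix.smul_apply, Matrix.one_apply, smul_eq_mul, mul_ite,
    mul_one, mul_zero, Fintype.card_fin] at h
  rw [← h, pow_mul, eq_inv_of_mul_eq_one_left hκ', inv_pow]

variable [Fintype S]

theorem norm_interact_le_one {κ : ℝ} (hκ : κ ^ 2 * Fintype.card D = 1)
    {WL : Matrix (A₀ × Z₀) (Q₀ × (X₀ × (Fin (n + 1) → Y₀))) ℂ}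
    {WR : Matrix (A₁ × Z₁) (Q₁ × (X₁ × (Fin (n + 1) → Y₁))) ℂ}
    (hWL : WLᴴ * WL = 1) (hWR : WRᴴ * WR = 1)
    {V : Matrix (X₀ × X₁) (S × D) ℂ} (hV : Vᴴ * V = 1) {R : Matrix (Y₀ × Y₁) D ℂ}
    (hR : Rᴴ * R = 1) {B : Matrix (Q₀ × Q₁) (D × (Fin (n + 1) → D)) ℂ}
    (hB : portTrace (Bᴴ * B) = 1) :
    ‖interact WL WR (leftState κ V) (rightState n κ R) B‖ ≤ 1 := by
  apply Matrix.norm_le_one_of_isometry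
  rw [gram_interact hWL hWR, port_expectation hκ hV hR (c := 1) (by rw [hB, one_smul]), one_smul]

/-- The operator of a local protocol is small as soon as `B† B` is bounded by an observable that is
small on average over the ports. -/
theorem norm_interact_le {κ : ℝ} (hκ : κ ^ 2 * Fintype.card D = 1)
    {WL : Matrix (A₀ × Z₀) (Q₀ × (X₀ × (Fin (n + 1) → Y₀))) ℂ}
    {WR : Matrix (A₁ × Z₁) (Q₁ × (X₁ × (Fin (n + 1) → Y₁))) ℂ}
    (hWL : WLᴴ * WL = 1) (hWR : WRᴴ * WR = 1)
    {V : Matrix (X₀ × X₁) (S × D) ℂ} (hV : Vᴴ * V = 1) {R : Matrix (Y₀ × Y₁) D ℂ}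
    (hR : Rᴴ * R = 1) {B : Matrix (Q₀ × Q₁) (D × (Fin (n + 1) → D)) ℂ}
    {H : Matrix (D × (Fin (n + 1) → D)) (D × (Fin (n + 1) → D)) ℂ} {η : ℝ} (hη : 0 ≤ η)
    (hH : portTrace H = ((η ^ 2 : ℝ) : ℂ) • 1) (hB : (H - Bᴴ * B).PosSemidef) :
    ‖interact WL WR (leftState κ V) (rightState n κ R) B‖ ≤ η := by
  apply Matrix.norm_le_of_posSemidef_sub hη
  rw [gram_interact hWL hWR, ← port_expectation hκ hV hR hH, ← Matrix.sub_mul, ← Matrix.mul_sub]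
  have h1 := (hB.kronecker (Matrix.PosSemidef.one (n := (X₀ × X₁) ×
    ((Fin (n + 1) → Y₀) × (Fin (n + 1) → Y₁))) (R := ℂ))).conjTranspose_mul_mul_same
      (prepared (leftState κ V) (rightState n κ R))
  have h2 : ∀ K : Matrix (D × (Fin (n + 1) → D)) (D × (Fin (n + 1) → D)) ℂ,
      (H - K) ⊗ₖ (1 : Matrix ((X₀ × X₁) × ((Fin (n + 1) → Y₀) × (Fin (n + 1) → Y₁)))
        ((X₀ × X₁) × ((Fin (n + 1) → Y₀) × (Fin (n + 1) → Y₁))) ℂ) = H ⊗ₖ 1 - K ⊗ₖ 1 := by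
    intro K
    ext p q
    simp [sub_mul]
  rw [← h2]
  exact h1

end NormBounds

/-! ### From non-local protocols to interaction protocols -/

/-- The isometry that adjoins a register for the index of a port, in a fixed state. -/
def adjoinIndex {n : ℕ} {D Q : Type*} [DecidableEq Q] (e : Q ≃ D × Fin (n + 1)) : Matrix Q D ℂ :=
  (1 : Matrix Q Q ℂ).submatrix id fun v => e.symm (v, 0)

theorem adjoinIndex_isometry {n : ℕ} {D Q : Type*} [DecidableEq Q] [Fintype Q] [DecidableEq D]
    (e : Q ≃ D × Fin (n + 1)) : (adjoinIndex e)ᴴ * adjoinIndex e = 1 := by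
  ext v v'
  simp [adjoinIndex, Matrix.mul_apply, Matrix.one_apply, eq_comm]

theorem isometry_kronecker_one_mul {m n k s : Type*} [Fintype m] [Fintype n] [Fintype k]
    [DecidableEq n] [DecidableEq k] [DecidableEq s] {J : Matrix m n ℂ} (hJ : Jᴴ * J = 1)
    {V : Matrix (n × k) s ℂ} (hV : Vᴴ * V = 1) :
    ((J ⊗ₖ (1 : Matrix k k ℂ)) * V)ᴴ * ((J ⊗ₖ (1 : Matrix k k ℂ)) * V) = 1 := by
  rw [Matrix.conjTranspose_mul, Matrix.mul_assoc, ← Matrix.mul_assoc _ (J ⊗ₖ _) V,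
    Matrix.conjTranspose_kronecker, ← Matrix.mul_kronecker_mul, hJ, Matrix.conjTranspose_one,
    Matrix.mul_one, Matrix.one_kronecker_one, Matrix.one_mul, hV]

theorem rightState_isometry {n : ℕ} {Y₀ Y₁ D : Type*} [Fintype Y₀] [Fintype Y₁] [Fintype D]
    [DecidableEq D] {κ : ℝ} (hκ : κ ^ 2 * Fintype.card D = 1) {R : Matrix (Y₀ × Y₁) D ℂ}
    (hR : Rᴴ * R = 1) : (rightState n κ R)ᴴ * rightState n κ R = 1 := by
  have hκ' : (κ : ℂ) ^ 2 * Fintype.card D = 1 := by exact_mod_cast hκ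
  ext ⟨⟩ ⟨⟩
  rw [Matrix.mul_apply, Fintype.sum_prod_type (α₁ := Fin (n + 1) → D)]
  have h := fun w => rightState_gram (n := n) (κ := κ) hR w w
  simp only [if_true] at h
  simp only [Matrix.conjTranspose_apply, h, Finset.sum_const, Finset.card_univ, nsmul_eq_mul,
    Fintype.card_fun, Fintype.card_fin, Matrix.one_apply, if_true]
  push_cast
  rw [pow_mul, ← mul_pow, mul_comm, hκ', one_pow]

namespace OneSidedTask

variable {T : OneSidedTask} {E n a b : ℕ}

theorem eprAmplitude_eq (v₀ v₁ : Qubits E) :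
    eprAmplitude E v₀ v₁ = if v₀ = v₁ then (((1 / √2) ^ E : ℝ) : ℂ) else 0 := by
  rw [eprAmplitude]
  split_ifs with h
  · subst h; simp
  · obtain ⟨i, hi⟩ := Function.ne_iff.1 h
    exact Finset.prod_eq_zero (Finset.mem_univ i) (if_neg hi)

theorem NonlocalProtocol.operator_apply (P : T.NonlocalProtocol E) (x : T.Input) (a₀ : T.A₀)
    (z₀ : P.Z₀) (a₁ : T.A₁) (z₁ : P.Z₁) (s : T.A₀ × T.A₁) :
    P.operator x ((a₀, z₀), (a₁, z₁)) s = ∑ m₀, ∑ m₁, P.WL x (a₀, z₀) m₀ * P.WR x (a₁, z₁) m₁ *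
      ∑ u, (((1 / √2) ^ E : ℝ) : ℂ) * P.VL (m₀.1, m₁.1) (s, u) * P.VR x (m₀.2, m₁.2) u := by
  rw [operator, Matrix.mul_apply, Fintype.sum_prod_type (α₁ := P.X₀ × P.Y₀)]
  refine Fintype.sum_congr _ _ fun m₀ => Fintype.sum_congr _ _ fun m₁ => ?_
  rw [Matrix.kroneckerMap_apply, Matrix.submatrix_apply, Matrix.mul_apply]
  congr 1
  simp only [Fintype.sum_prod_type (α₂ := Qubits E), Matrix.kroneckerMap_apply, adjoinEPR,
    Matrix.of_apply, eprAmplitude_eq, id]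
  rw [Finset.sum_eq_single s (fun t _ h => by simp [h]) (by simp)]
  refine Fintype.sum_congr _ _ fun u => ?_
  simp only [if_true, mul_ite, mul_zero, Finset.sum_ite_eq, Finset.mem_univ]
  ring

theorem sq_mul_card_qubits : ((1 / √2) ^ E : ℝ) ^ 2 * Fintype.card (Qubits E) = 1 := by
  rw [← pow_mul, mul_comm E 2, pow_mul, div_pow, Real.sq_sqrt zero_le_two, Fintype.card_fun,
    Fintype.card_fin, Fintype.card_fin]
  push_cast
  rw [← mul_pow]
  norm_num

/-- The local protocol obtained from a non-local protocol by port-based teleportation. The left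
creates the entangled state itself and brings its half `V₁` to the interaction. The right runs its part
of the protocol on every port beforehand, so that the messages for all ports can be exchanged; the
interaction `U` has to teleport `V₁` into one of the ports and to tell both sides which one. -/
def NonlocalProtocol.toInteraction (P : T.NonlocalProtocol E)
    (e₀ : Qubits a ≃ Qubits E × Fin (n + 1))
    (e₁ : Qubits b ≃ (Fin (n + 1) → Qubits E) × Fin (n + 1))
    (U : Matrix.unitaryGroup (Qubits a × Qubits b) ℂ) : T.InteractionProtocol a b where
  X₀ := P.X₀
  X₁ := P.X₁
  Y₀ := Fin (n + 1) → P.Y₀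
  Y₁ := Fin (n + 1) → P.Y₁
  Z₀ := P.Z₀ × (Qubits E × (Fin (n + 1) × (Fin n → P.Y₀)))
  Z₁ := P.Z₁ × ((Fin (n + 1) → Qubits E) × (Fin (n + 1) × (Fin n → P.Y₁)))
  VL := (adjoinIndex e₀ ⊗ₖ 1) * leftState ((1 / √2) ^ E) P.VL
  VR x := (adjoinIndex e₁ ⊗ₖ 1) * rightState n ((1 / √2) ^ E) (P.VR x)
  UI := U
  WL x := selectPort (P.WL x) e₀
  WR x := selectPort (P.WR x) e₁
  VL_isometry := isometry_kronecker_one_mul (adjoinIndex_isometry e₀)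
    (leftState_isometry sq_mul_card_qubits P.VL_isometry)
  VR_isometry x := isometry_kronecker_one_mul (adjoinIndex_isometry e₁)
    (rightState_isometry sq_mul_card_qubits (P.VR_isometry x))
  WL_isometry x := selectPort_isometry (P.WL_isometry x) e₀
  WR_isometry x := selectPort_isometry (P.WR_isometry x) e₁

open scoped Matrix.Norms.L2Operator in
/-- For the unitary closest to the ideal measurement, the local protocol is close to the non-local
one. -/
theorem NonlocalProtocol.exists_toInteraction_near (P : T.NonlocalProtocol E)
    (e₀ : Qubits a ≃ Qubits E × Fin (n + 1))
    (e₁ : Qubits b ≃ (Fin (n + 1) → Qubits E) × Fin (n + 1)) :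
    ∃ U, ∀ x, diamondNorm (P.channel x - (P.toInteraction e₀ e₁ U).channel x)
      ≤ ENNReal.ofReal (2 * √((4 ^ E - 1) / (n + 1))) := by
  classical
  set J := adjoinIndex e₀ ⊗ₖ adjoinIndex e₁ with hJdef
  have hJ : Jᴴ * J = 1 := by
    rw [hJdef, Matrix.conjTranspose_kronecker, ← Matrix.mul_kronecker_mul, adjoinIndex_isometry,
      adjoinIndex_isometry, Matrix.one_kronecker_one]
  set M := portMeasurement e₀ e₁ with hM
  obtain ⟨U, hU, hUM⟩ := Matrix.exists_unitary_mul_isometry_near hJ M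
  refine ⟨⟨U, hU⟩, fun x => ?_⟩
  set κ : ℝ := (1 / √2) ^ E with hκdef
  have hκ : κ ^ 2 * Fintype.card (Qubits E) = 1 := sq_mul_card_qubits
  set WL := selectPort (P.WL x) e₀ with hWLdef
  set WR := selectPort (P.WR x) e₁ with hWRdef
  have hWL : WLᴴ * WL = 1 := selectPort_isometry (P.WL_isometry x) e₀
  have hWR : WRᴴ * WR = 1 := selectPort_isometry (P.WR_isometry x) e₁
  -- `O` is the operator of the local protocol, `O'` the one with the ideal measurement
  set O := interact WL WR (leftState κ P.VL) (rightState n κ (P.VR x)) (U * J) with hO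
  set O' := interact WL WR (leftState κ P.VL) (rightState n κ (P.VR x)) M with hO'
  have h1 : (P.toInteraction e₀ e₁ ⟨U, hU⟩).channel x = fun ρ => traceOutZ (conjBy O ρ) := by
    have : (P.toInteraction e₀ e₁ ⟨U, hU⟩).operator x = O := interact_mul _ _ _ _ _ _ _
    funext ρ
    change traceOutZ (conjBy ((P.toInteraction e₀ e₁ ⟨U, hU⟩).operator x) ρ) = _
    rw [this]
    rfl
  have h2 : P.channel x = fun ρ => traceOutZ (conjBy O' ρ) := by
    funext ρ
    refine (traceOutZ_conjBy_of_eq_mul (residue_norm hκ (P.VR_isometry x)) ?_ ρ).symm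
    intro a₀ z₀ g₀ a₁ z₁ g₁ s
    rw [NonlocalProtocol.operator_apply]
    exact interact_selectPort_portMeasurement _ _ _ _ _ _ _ _ _ _ _ _ _ _
  have hU1 : (U * J)ᴴ * (U * J) = 1 := by
    rw [Matrix.conjTranspose_mul, Matrix.mul_assoc, ← Matrix.mul_assoc _ U J,
      show Uᴴ * U = 1 from Matrix.mem_unitaryGroup_iff'.1 hU, Matrix.one_mul, hJ]
  have hn1 : ‖O'‖ ≤ 1 := norm_interact_le_one hκ hWL hWR P.VL_isometry (P.VR_isometry x) (by
    rw [hM, gram_portMeasurement, portTrace_gram])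
  have hn2 : ‖O‖ ≤ 1 := norm_interact_le_one hκ hWL hWR P.VL_isometry (P.VR_isometry x) (by
    rw [hU1, portTrace_one])
  have hη0 : (0 : ℝ) ≤ (4 ^ E - 1) / (n + 1) :=
    div_nonneg (sub_nonneg.2 (one_le_pow₀ (by norm_num))) (by positivity)
  have hn3 : ‖O' - O‖ ≤ √((4 ^ E - 1) / (n + 1)) := by
    rw [← norm_neg, neg_sub, hO, hO', ← interact_sub]
    refine norm_interact_le hκ hWL hWR P.VL_isometry (P.VR_isometry x) (Real.sqrt_nonneg _) ?_ hUM
    rw [hM, gram_portMeasurement, portTrace_one_sub_gram_sq, Real.sq_sqrt hη0]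
    congr 1
    simp only [Fintype.card_fun, Fintype.card_fin]
    push_cast
    rw [← pow_mul, mul_comm E 2, pow_mul]
    norm_num
  rw [h1, h2]
  exact diamondNorm_traceOutZ_sub_le (Real.sqrt_nonneg _) hn1 hn2 hn3

theorem exists_nonlocalProtocol_of_entanglementCost_eq {δ : ℝ}
    (h : T.entanglementCost δ = (E : ℕ∞)) :
    ∃ P : T.NonlocalProtocol E, ∀ x,
      diamondNorm (conjBy (T.U x : Matrix (T.A₀ × T.A₁) (T.A₀ × T.A₁) ℂ) - P.channel x)
        ≤ ENNReal.ofReal δ := by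
  obtain ⟨E', hE'⟩ := ciInf_mem fun E : ℕ => ⨅ (_ : ∃ P : T.NonlocalProtocol E, ∀ x,
    diamondNorm (conjBy (T.U x : Matrix (T.A₀ × T.A₁) (T.A₀ × T.A₁) ℂ) - P.channel x)
      ≤ ENNReal.ofReal δ), (E : ℕ∞)
  change _ = T.entanglementCost δ at hE'
  rw [h] at hE'
  by_cases hp : ∃ P : T.NonlocalProtocol E', ∀ x,
    diamondNorm (conjBy (T.U x : Matrix (T.A₀ × T.A₁) (T.A₀ × T.A₁) ℂ) - P.channel x)
      ≤ ENNReal.ofReal δ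
  · simp only [hp, iInf_pos, Nat.cast_inj] at hE'
    exact hE' ▸ hp
  · simp [hp] at hE'

/-- Port-based teleportation with `2 ^ m` ports. -/
theorem minInteractionQubits_le {δ ε : ℝ} (hδ : 0 ≤ δ) (P : T.NonlocalProtocol E)
    (hP : ∀ x, diamondNorm (conjBy (T.U x : Matrix (T.A₀ × T.A₁) (T.A₀ × T.A₁) ℂ) - P.channel x)
      ≤ ENNReal.ofReal δ) (m : ℕ) (hm : 2 * √((4 ^ E - 1) / 2 ^ m) ≤ ε - δ) :
    T.minInteractionQubits ε ≤ ((E + m + (2 ^ m * E + m) : ℕ) : ℕ∞) := by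
  obtain ⟨n, hn⟩ : ∃ n, 2 ^ m = n + 1 := Nat.exists_eq_add_one.2 (by positivity)
  let e₀ : Qubits (E + m) ≃ Qubits E × Fin (n + 1) := Fintype.equivOfCardEq (by
    simp [← hn, pow_add])
  let e₁ : Qubits (2 ^ m * E + m) ≃ (Fin (n + 1) → Qubits E) × Fin (n + 1) :=
    Fintype.equivOfCardEq (by
      simp [← hn, pow_add, ← pow_mul, mul_comm])
  obtain ⟨U, hU⟩ := P.exists_toInteraction_near e₀ e₁
  refine iInf_le_of_le (E + m) (iInf_le_of_le (2 ^ m * E + m) (iInf_le_of_le ⟨U, ?_⟩ le_rfl))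
  refine ⟨P.toInteraction e₀ e₁ U, rfl, fun x => ?_⟩
  refine (diamondNorm_sub_le _ (P.channel x) _).trans ((add_le_add (hP x) (hU x)).trans ?_)
  rw [← ENNReal.ofReal_add hδ (by positivity)]
  apply ENNReal.ofReal_le_ofReal
  have : ((2 : ℝ) ^ m) = n + 1 := by exact_mod_cast hn
  rw [this] at hm
  linarith

end OneSidedTask

/-- The number of qubits of the interaction for `2 ^ (2 * E + k)` ports. -/
theorem qubits_count_le (E k : ℕ) :
    E + (2 * E + k) + (2 ^ (2 * E + k) * E + (2 * E + k)) ≤ (5 + 2 * k + 2 ^ k) * 2 ^ (8 * E) := by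
  have h1 : E ≤ 2 ^ E := Nat.lt_two_pow_self.le
  have h2 : 2 ^ E ≤ 2 ^ (8 * E) := Nat.pow_le_pow_right (by norm_num) (by omega)
  have h3 : 1 ≤ 2 ^ (8 * E) := Nat.one_le_two_pow
  have h4 : 2 ^ (2 * E + k) * E ≤ 2 ^ k * 2 ^ (8 * E) := by
    calc 2 ^ (2 * E + k) * E ≤ 2 ^ (2 * E + k) * 2 ^ E := Nat.mul_le_mul_left _ h1
      _ = 2 ^ k * 2 ^ (3 * E) := by rw [← pow_add, ← pow_add]; congr 1; ring
      _ ≤ _ := Nat.mul_le_mul_left _ (Nat.pow_le_pow_right (by norm_num) (by omega))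
  nlinarith

end

theorem mainTheorem4 (δ ε : ℝ) (hδ : 0 ≤ δ) (hε : δ < ε) :
    ∃ c C : ℝ, 0 < c ∧ 0 < C ∧
      ∀ (T : OneSidedTask) (E : ℕ), T.entanglementCost δ = (E : ℕ∞) →
        ∃ n' : ℕ, T.minInteractionQubits ε = (n' : ℕ∞) ∧
          (n' : ℝ) ≤ C * 2 ^ (8 * E) ∧
          c * Real.logb 2 (n' : ℝ) ≤ (E : ℝ) := by
  -- `4 ^ E * 2 ^ k` ports make the error of the teleportation at most `ε - δ`
  obtain ⟨k, hk⟩ := pow_unbounded_of_one_lt (4 / (ε - δ) ^ 2) one_lt_two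
  have hgap : 0 < ε - δ := sub_pos.2 hε
  have hk' : 4 / 2 ^ k ≤ (ε - δ) ^ 2 := by
    rw [div_lt_iff₀ (by positivity)] at hk
    rw [div_le_iff₀ (by positivity)]
    linarith
  set C : ℝ := 5 + 2 * k + 2 ^ k with hC
  have hC1 : 1 ≤ C := by
    have : (0 : ℝ) ≤ 2 ^ k := by positivity
    have : (0 : ℝ) ≤ k := k.cast_nonneg
    linarith
  have hlogC : 0 ≤ Real.logb 2 C := Real.logb_nonneg one_lt_two hC1
  refine ⟨1 / (Real.logb 2 C + 8), C, by positivity, by linarith, fun T E hE => ?_⟩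
  obtain ⟨P, hP⟩ := OneSidedTask.exists_nonlocalProtocol_of_entanglementCost_eq hE
  have hfin : ∀ N : ℕ, T.minInteractionQubits ε ≤ (N : ℕ∞) →
      ∃ n' : ℕ, T.minInteractionQubits ε = (n' : ℕ∞) ∧ n' ≤ N := by
    intro N hN
    obtain ⟨n', hn'⟩ := ENat.ne_top_iff_exists.1 (ne_top_of_le_ne_top (ENat.natCast_ne_top N) hN)
    exact ⟨n', hn'.symm, by rw [← hn'] at hN; exact_mod_cast hN⟩
  rcases Nat.eq_zero_or_pos E with rfl | hEpos
  -- without entanglement the bound on `log n'` leaves only `n' ≤ 1`; a single port, of dimension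
  -- one, gives an exact protocol without qubits
  · obtain ⟨n', hn', hle⟩ := hfin _ (T.minInteractionQubits_le hδ P hP 0 (by simp; linarith))
    have : n' = 0 := by simpa using hle
    subst this
    exact ⟨0, hn', by simp; linarith, by simp⟩
  · obtain ⟨n', hn', hle⟩ := hfin _ (T.minInteractionQubits_le hδ P hP (2 * E + k) (by
      have h1 : ((4 : ℝ) ^ E - 1) / 2 ^ (2 * E + k) ≤ 1 / 2 ^ k := by
        rw [div_le_div_iff₀ (by positivity) (by positivity), pow_add, pow_mul]
        norm_num
      have h2 : √(((4 : ℝ) ^ E - 1) / 2 ^ (2 * E + k)) ≤ (ε - δ) / 2 := by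
        apply Real.sqrt_le_iff.2 ⟨by positivity, h1.trans _⟩
        rw [div_pow]
        have : (4 : ℝ) / 2 ^ k = 4 * (1 / 2 ^ k) := by ring
        linarith
      linarith))
    have hn : (n' : ℝ) ≤ C * 2 ^ (8 * E) := by
      have := hle.trans (qubits_count_le E k)
      rw [hC]
      exact_mod_cast this
    refine ⟨n', hn', hn, ?_⟩
    have hE1 : (1 : ℝ) ≤ E := by exact_mod_cast hEpos
    rw [one_div, inv_mul_le_iff₀ (by positivity)]
    rcases Nat.eq_zero_or_pos n' with rfl | hpos
    · simp; positivity
    · have h1 : Real.logb 2 n' ≤ Real.logb 2 (C * 2 ^ (8 * E)) :=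
        Real.logb_le_logb_of_le one_lt_two (by exact_mod_cast hpos) hn
      rw [Real.logb_mul (by positivity) (by positivity), Real.logb_pow,
        Real.logb_self_eq_one one_lt_two] at h1
      push_cast at h1
      nlinarith
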